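/- Let $n\ge 2$, let $\mathbb{H}^n=\{x\in\mathbb{R}^n : x_n>0\}$ carry the hyperbolic metric $ds^2=(dx_1^2+\cdots+dx_n^2)/x_n^2$, and let $\mathbb{H}^n\times\mathbb{R}$ carry the Riemannian product metric $ds^2+dt^2$. Let $M$ be a connected smooth $n$-dimensional manifold and let $X:M\to\mathbb{H}^n\times\mathbb{R}$ be a smooth immersed hypersurface of constant mean curvature $H$ (that is, locally $X(M)$ is a regular level set $\{f=0\}$ of a smooth function $f$ with $nH=-\operatorname{div}(\nabla f/|\nabla f|)$ along $X(M)$). Suppose that $M$ carries a smooth codimension-one foliation each of whose leaves is mapped by $X$ bijectively onto an $(n-1)$-dimensional geodesic sphere of a horizontal slice $\mathbb{H}^n\times\{t\}$ (with $t$ depending on the leaf), and that $X(M)$ is not contained in a single horizontal slice. If $H\neq 0$, or if $H=0$ and $n\geq 3$, then $M$ is rotationally symmetric about a vertical geodesic: there is a point $q\in\mathbb{H}^n$ such that the spheres which are the images of the leaves all have hyperbolic center on the vertical line $\{q\}\times\mathbb{R}$, and $X(M)$ is invariant under $g\times\mathrm{id}$ for every isometry $g$ of $\mathbb{H}^n$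 that fixes $q$. -/

import Mathlib

open scoped Manifold ContDiff Topology

noncomputable section

namespace HypProd

/-- The coordinate space `ℝⁿ` with `n = m + 1`. -/
abbrev Coord (m : ℕ) : Type := EuclideanSpace ℝ (Fin (m + 1))

/-- The last coordinate `x_n` of a point of `ℝⁿ`, `n = m + 1`. -/
def height {m : ℕ} (x : Coord m) : ℝ := x (Fin.last m)

/-- The upper half-space model of hyperbolic space `ℍⁿ`, `n = m + 1`, as a subset of `ℝⁿ`. -/
def halfSpace (m : ℕ) : Set (Coord m) := {x | 0 < height x}

/-- The distance of the hyperbolic metric `(dx₁² + ⋯ + dx_n²) / x_n²` on the upper half-space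
(the same formula as in Mathlib's `UpperHalfPlane.dist_eq`). -/
def hdist {m : ℕ} (x y : Coord m) : ℝ :=
  2 * Real.arsinh (dist x y / (2 * √(height x * height y)))

/-- The geodesic sphere of `ℍⁿ` with hyperbolic center `c` and hyperbolic radius `R`. -/
def hsphere {m : ℕ} (c : Coord m) (R : ℝ) : Set (Coord m) :=
  {x | x ∈ halfSpace m ∧ hdist x c = R}

/-- Isometries of `ℍⁿ` (given by a map on coordinates; only its values on `ℍⁿ` matter). -/
def IsHypIsometry {m : ℕ} (g : Coord m → Coord m) : Prop :=
  Set.BijOn g (halfSpace m) (halfSpace m) ∧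
    ∀ x ∈ halfSpace m, ∀ y ∈ halfSpace m, hdist (g x) (g y) = hdist x y

/-- The Riemannian product metric `(dx₁² + ⋯ + dx_n²) / x_n² + dt²` on `ℍⁿ × ℝ`,
at the point `p`. -/
def metric {m : ℕ} (p v w : Coord m × ℝ) : ℝ :=
  (∑ i, v.1 i * w.1 i) / height p.1 ^ 2 + v.2 * w.2

/-- The gradient of `f` for the product metric: `∇f = ∑ g^{ij} ∂_i f ∂_j`, that is
`(x_n² ∂₁f, …, x_n² ∂_n f, ∂_t f)`. -/
def grad {m : ℕ} (f : Coord m × ℝ → ℝ) (p : Coord m × ℝ) : Coord m × ℝ :=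
  (WithLp.toLp 2 fun i => height p.1 ^ 2 * fderiv ℝ f p (EuclideanSpace.single i 1, 0),
    fderiv ℝ f p (0, 1))

/-- `grad f` represents the differential of `f` for the product metric. -/
theorem metric_grad {m : ℕ} (f : Coord m × ℝ → ℝ) (p w : Coord m × ℝ)
    (hp : p.1 ∈ halfSpace m) : metric p (grad f p) w = fderiv ℝ f p w := by
  have hh : height p.1 ≠ 0 := ne_of_gt hp
  have hw : w = ∑ i, w.1 i • ((EuclideanSpace.single i (1 : ℝ), 0) : Coord m × ℝ)
      + w.2 • ((0, 1) : Coord m × ℝ) := by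
    ext j
    · simp [Prod.fst_sum, Finset.sum_apply, Pi.single_apply]
    · simp [Prod.snd_sum]
  conv_rhs => rw [hw]
  simp only [map_add, map_sum, map_smul, smul_eq_mul, metric, grad, Finset.sum_div]
  congr 1
  · refine Finset.sum_congr rfl fun i _ => ?_
    field_simp
  · ring

/-- The length `|∇f|` for the product metric. -/
def gradNorm {m : ℕ} (f : Coord m × ℝ → ℝ) (p : Coord m × ℝ) : ℝ :=
  √(metric p (grad f p) (grad f p))

/-- The volume density `√(det g) = x_n⁻ⁿ` of the product metric. -/
def volDensity {m : ℕ} (p : Coord m × ℝ) : ℝ := (height p.1 ^ (m + 1))⁻¹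

/-- The divergence `∑_j (√g)⁻¹ ∂_j (√g Z^j)` of a vector field on `ℍⁿ × ℝ`. -/
def divergence {m : ℕ} (Z : Coord m × ℝ → Coord m × ℝ) (p : Coord m × ℝ) : ℝ :=
  (volDensity p)⁻¹ *
    ((∑ i, fderiv ℝ (fun y => volDensity y * (Z y).1 i) p (EuclideanSpace.single i 1, 0))
      + fderiv ℝ (fun y => volDensity y * (Z y).2) p (0, 1))

/-- The mean curvature `H` at `p` of the level set of `f` through `p`, for the unit normal
`N = -∇f / |∇f|`, determined by `n H = -div (∇f / |∇f|)` with `n = m + 1`. -/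
def levelMeanCurvature {m : ℕ} (f : Coord m × ℝ → ℝ) (p : Coord m × ℝ) : ℝ :=
  -divergence (fun y => (gradNorm f y)⁻¹ • grad f y) p / ((m : ℝ) + 1)

section Hypersurface

variable {m : ℕ} {M : Type*} [TopologicalSpace M] [ChartedSpace (Coord m) M]

/-- `X` is a smooth immersion of the `n`-manifold `M` in `ℍⁿ × ℝ`, `n = m + 1`. -/
structure IsImmersedHypersurface (X : M → Coord m × ℝ) : Prop where
  mem_halfSpace : ∀ p, (X p).1 ∈ halfSpace m
  smooth : ContMDiff 𝓘(ℝ, Coord m) 𝓘(ℝ, Coord m × ℝ) ∞ X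
  immersive : ∀ p, Function.Injective (mfderiv 𝓘(ℝ, Coord m) 𝓘(ℝ, Coord m × ℝ) X p)

/-- The immersed hypersurface `X` has constant mean curvature `H`: near every point it lies in a
regular level set of a smooth function `f`, and the mean curvature of that level set equals `H`
along the hypersurface. (Passing from `f` to `-f` reverses the unit normal and the sign of the
mean curvature. For `H ≠ 0` the local normals chosen here fit together to a global one.) -/
def HasConstantMeanCurvature (X : M → Coord m × ℝ) (H : ℝ) : Prop :=
  ∀ p : M, ∃ (U : Set (Coord m × ℝ)) (f : Coord m × ℝ → ℝ),
    IsOpen U ∧ X p ∈ U ∧ ContDiffOn ℝ ∞ f U ∧ (∀ y ∈ U, fderiv ℝ f y ≠ 0) ∧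
      ∀ᶠ v in 𝓝 p, f (X v) = 0 ∧ levelMeanCurvature f (X v) = H

/-- The equivalence relation `F` ("to lie on the same leaf") is a smooth codimension-one foliation
of `M`, each of whose leaves is mapped bijectively by `X` onto a geodesic sphere of positive
radius in a horizontal slice `ℍⁿ × {t}`. Locally the plaques are the level sets of a
submersion `s`. -/
structure IsFoliationByHorizontalSpheres (X : M → Coord m × ℝ) (F : Setoid M) : Prop where
  plaque : ∀ p : M, ∃ (V : Set M) (s : M → ℝ), IsOpen V ∧ p ∈ V ∧
    ContMDiffOn 𝓘(ℝ, Coord m) 𝓘(ℝ, ℝ) ∞ s V ∧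
    (∀ x ∈ V, mfderiv 𝓘(ℝ, Coord m) 𝓘(ℝ, ℝ) s x ≠ 0) ∧
    ∀ x ∈ V, ∀ y ∈ V, s x = s y → F x y
  leaf : ∀ p : M, ∃ c ∈ halfSpace m, ∃ R > 0, ∃ t : ℝ,
    Set.BijOn X {x | F p x} (hsphere c R ×ˢ {t})

end Hypersurface

/-- The set `S` is rotationally symmetric about the vertical geodesic `{q} × ℝ`: it is invariant
under `g × id` for every isometry `g` of `ℍⁿ` that fixes `q`. -/
def IsRotationallySymmetricAbout {m : ℕ} (S : Set (Coord m × ℝ)) (q : Coord m) : Prop :=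
  ∀ g : Coord m → Coord m, IsHypIsometry g → g q = q →
    (fun p : Coord m × ℝ => (g p.1, p.2)) '' S = S

end HypProd

end

/-! In the half-space model a geodesic sphere is a Euclidean sphere. Let `c` be its Euclidean
center, `k` the height of `c`, and `ρ` the squared Euclidean radius. The hyperbolic center has the
same horizontal coordinates as `c`, and its squared height is `k² - ρ`. Along a family of leaves it
is therefore stationary exactly when `k c' = (ρ'/2) e_n`, with `e_n` the last coordinate vector.
Everything reduces to this identity.

Where the height `t` of the leaves is a good parameter, the hypersurface is the zero set of `(|x -
c(t)|² - ρ(t))/2`. Its mean curvature equation, squared, reads `(nH)² (h²ρ + φ²)³ = h² K²`, with `h`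
the height of `x`, `φ` the `t`-derivative of the defining function, and `K` a polynomial expression
(`mcNum_sphereFun`). On a great circle of a leaf, `h` and `φ` are affine in `cos z` and `sin z`, so
the identity extends from a real arc to all complex `z`. At a complex zero of `h` it gives `φ = 0`
if `H ≠ 0`. If `H = 0`, then `K` vanishes identically, and at a zero of `h` it equals `(m - 1) k
φ²`, so again `φ = 0` when `m ≠ 1`, that is `n ≥ 3`. Since `ρ < k²`, the zeros of `h` are nonreal
and give two values of `(cos z, sin z)`, which is enough to make `φ` proportional to `h`
(`proportional_of_arc_identity`). Letting the circle vary gives the identity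
(`height_smul_deriv_center`).

Where `t` is stationary, the identity follows by continuity unless a whole piece is horizontal. A
horizontal piece forces `H = 0`. In that case the derivative of `t` across the leaves solves a
linear ODE near any leaf where it vanishes, so horizontality propagates, and connectedness puts all
of `X(M)` in one slice (`nowhere_horizontal`). Hence the hyperbolic center is locally constant on
the connected manifold `M` (`center_eq`). The image is then a union of spheres about one vertical
line, each invariant under the isometries fixing the center. -/

open scoped Manifold ContDiff Topology

noncomputable section

namespace HypProd

/-! ### Mean curvature of a level set through its first two differentials -/

/-- The coordinate vector `∂_i` of `ℝⁿ × ℝ`. -/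
def bx {m : ℕ} (i : Fin (m + 1)) : Coord m × ℝ := (EuclideanSpace.single i 1, 0)

/-- The vertical coordinate vector `∂_t` of `ℝⁿ × ℝ`. -/
def bt {m : ℕ} : Coord m × ℝ := (0, 1)

/-- The gradient at height `h` of a function with differential `A`. -/
def gradOf {m : ℕ} (h : ℝ) (A : Coord m × ℝ →L[ℝ] ℝ) : Coord m × ℝ :=
  (WithLp.toLp 2 fun i => h ^ 2 * A (bx i), A bt)

/-- The squared length of the gradient at height `h` of a function with differential `A`. -/
def normSqOf {m : ℕ} (h : ℝ) (A : Coord m × ℝ →L[ℝ] ℝ) : ℝ :=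
  h ^ 2 * ∑ i, A (bx i) ^ 2 + A bt ^ 2

/-- The second order part of the numerator of the mean curvature. -/
def mcSecond {m : ℕ} (h : ℝ) (A : Coord m × ℝ →L[ℝ] ℝ)
    (B : Coord m × ℝ →L[ℝ] Coord m × ℝ →L[ℝ] ℝ) : ℝ :=
  normSqOf h A * (h ^ 2 * ∑ i, B (bx i) (bx i) + B bt bt) - B (gradOf h A) (gradOf h A)

/-- The numerator of the mean curvature of the level set of a function with differential `A` and
second differential `B`, at height `h`. -/
def mcNum {m : ℕ} (h : ℝ) (A : Coord m × ℝ →L[ℝ] ℝ)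
    (B : Coord m × ℝ →L[ℝ] Coord m × ℝ →L[ℝ] ℝ) : ℝ :=
  mcSecond h A B + normSqOf h A * ((1 - m) * h * A (bx (Fin.last m)))
    - h ^ 3 * A (bx (Fin.last m)) * ∑ i, A (bx i) ^ 2

theorem eq_sum_bx {m : ℕ} (w : Coord m × ℝ) : w = ∑ i, w.1 i • bx i + w.2 • bt := by
  ext j
  · simp [bx, bt, Prod.fst_sum, Finset.sum_apply, Pi.single_apply]
  · simp [bx, bt, Prod.snd_sum]

theorem apply_eq_sum {m : ℕ} (A : Coord m × ℝ →L[ℝ] ℝ) (w : Coord m × ℝ) :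
    A w = ∑ i, w.1 i * A (bx i) + w.2 * A bt := by
  conv_lhs => rw [eq_sum_bx w]
  simp [map_sum]

theorem apply_gradOf {m : ℕ} (h : ℝ) (A : Coord m × ℝ →L[ℝ] ℝ) :
    A (gradOf h A) = normSqOf h A := by
  rw [apply_eq_sum]
  simp only [gradOf, normSqOf, Finset.mul_sum]
  congr 1
  · exact Finset.sum_congr rfl fun i _ => by ring
  · ring

theorem normSqOf_pos {m : ℕ} {h : ℝ} (hh : 0 < h) {A : Coord m × ℝ →L[ℝ] ℝ} (hA : A ≠ 0) :
    0 < normSqOf h A := by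
  have h0 : 0 ≤ ∑ i, A (bx i) ^ 2 := Finset.sum_nonneg fun i _ => sq_nonneg _
  have h1 : 0 ≤ h ^ 2 * ∑ i, A (bx i) ^ 2 := by positivity
  rcases (add_nonneg h1 (sq_nonneg (A bt))).lt_or_eq with h2 | h2
  · exact h2
  · exfalso
    apply hA
    have h3 : A bt = 0 := by nlinarith [sq_nonneg (A bt)]
    have h4 : h ^ 2 * ∑ i, A (bx i) ^ 2 = 0 := by nlinarith [sq_nonneg (A bt)]
    have h5 : ∑ i, A (bx i) ^ 2 = 0 := by
      rcases mul_eq_zero.1 h4 with h6 | h6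
      · exact absurd h6 (by positivity)
      · exact h6
    have h6 := (Finset.sum_eq_zero_iff_of_nonneg fun i _ => sq_nonneg _).1 h5
    refine ContinuousLinearMap.ext fun w => ?_
    rw [apply_eq_sum]
    have h7 : ∀ i, A (bx i) = 0 := fun i => by simpa using h6 i (Finset.mem_univ i)
    simp [h3, h7]

/-- The height as a continuous linear functional on `ℝⁿ × ℝ`. -/
def heightL (m : ℕ) : Coord m × ℝ →L[ℝ] ℝ :=
  (EuclideanSpace.proj (Fin.last m)).comp (ContinuousLinearMap.fst ℝ (Coord m) ℝ)

theorem heightL_apply {m : ℕ} (y : Coord m × ℝ) : heightL m y = height y.1 := rfl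

theorem gradNorm_eq {m : ℕ} (f : Coord m × ℝ → ℝ) {y : Coord m × ℝ} (hy : height y.1 ≠ 0) :
    gradNorm f y = √(normSqOf (height y.1) (fderiv ℝ f y)) := by
  simp only [gradNorm, metric, grad, normSqOf, bx, bt, Finset.mul_sum, Finset.sum_div]
  congr 2
  · exact Finset.sum_congr rfl fun i _ => by field_simp
  · ring

theorem sum_fderiv_single {m : ℕ} (L : Coord m × ℝ →L[ℝ] ℝ) (Z : Coord m × ℝ) :
    ∑ i, Z.1 i * L (EuclideanSpace.single i 1, 0) + Z.2 * L (0, 1) = L Z :=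
  (apply_eq_sum L Z).symm

/-- With `Z = ∇f`, `W = |∇f|` and `μ = 1/(h^n W)`, the density times the unit field is `μ Z`, so the
divergence is `h^n (μ ∑ ∂_j Z^j + dμ(Z))`. The derivative of `W²` along `Z` supplies the term `B(Z,
Z)` and the cubic term in `h`; the coefficient `1 - m` is `2 - (m + 1)`, from differentiating `h²`
in the gradient and `h^{-n}` in the density. -/
theorem levelMeanCurvature_eq {m : ℕ} {f : Coord m × ℝ → ℝ} {P : Coord m × ℝ}
    (hf : ContDiffAt ℝ 2 f P) (hP : 0 < height P.1) (hA : fderiv ℝ f P ≠ 0) :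
    levelMeanCurvature f P =
      -(mcNum (height P.1) (fderiv ℝ f P) (fderiv ℝ (fderiv ℝ f) P)
        / √(normSqOf (height P.1) (fderiv ℝ f P)) ^ 3) / ((m : ℝ) + 1) := by
  set h := height P.1 with hh
  set A := fderiv ℝ f P with hAdef
  set B := fderiv ℝ (fderiv ℝ f) P with hB
  have hW := normSqOf_pos hP hA
  have hD : HasFDerivAt (fderiv ℝ f) B P :=
    ((hf.fderiv_right (m := 1) (by norm_num)).differentiableAt (by norm_num)).hasFDerivAt
  have hDv : ∀ v, HasFDerivAt (fun y => fderiv ℝ f y v) (B.flip v) P := fun v => by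
    have := hD.clm_apply (hasFDerivAt_const v P)
    refine this.congr_fderiv ?_
    refine ContinuousLinearMap.ext fun w => ?_
    simp
  have hH : HasFDerivAt (fun y : Coord m × ℝ => height y.1) (heightL m) P :=
    (heightL m).hasFDerivAt
  -- the derivative of the squared length of the gradient
  have hN : HasFDerivAt (fun y : Coord m × ℝ => normSqOf (height y.1) (fderiv ℝ f y))
      ((2 * h * ∑ i, A (bx i) ^ 2) • heightL m
        + (2 * h ^ 2) • ∑ i, A (bx i) • B.flip (bx i) + (2 * A bt) • B.flip bt) P := by
    have h1 : HasFDerivAt (fun y : Coord m × ℝ => ∑ i, (fderiv ℝ f y (bx i)) ^ 2)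
        (∑ i, (2 * A (bx i)) • B.flip (bx i)) P :=
      HasFDerivAt.fun_sum fun i _ => by
        refine ((hDv (bx i)).pow 2).congr_fderiv ?_
        simp [hAdef]
    refine (((hH.pow 2).fun_mul h1).fun_add ((hDv bt).pow 2)).congr_fderiv ?_
    refine ContinuousLinearMap.ext fun w => ?_
    simp only [add_apply, smul_apply,
      sum_apply, smul_eq_mul, Finset.mul_sum, ← hAdef, ← hh]
    simp only [Nat.add_one_sub_one, pow_one, nsmul_eq_mul, Nat.cast_ofNat]
    rw [Finset.sum_mul]
    have : ∀ a b c d e : ℝ, a = d → b = c → a + b + e = c + d + e := by intros; linarith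
    apply this
    · exact Finset.sum_congr rfl fun i _ => by ring
    · rw [Finset.sum_mul]; exact Finset.sum_congr rfl fun i _ => by ring
  obtain ⟨N', hN', hNZ⟩ : ∃ N' : Coord m × ℝ →L[ℝ] ℝ,
      HasFDerivAt (fun y : Coord m × ℝ => normSqOf (height y.1) (fderiv ℝ f y)) N' P ∧
      N' (gradOf h A) = 2 * (h ^ 3 * A (bx (Fin.last m)) * ∑ i, A (bx i) ^ 2
        + B (gradOf h A) (gradOf h A)) := by
    refine ⟨_, hN, ?_⟩
    have e1 : B (gradOf h A) (gradOf h A)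
        = ∑ i, h ^ 2 * A (bx i) * B (gradOf h A) (bx i) + A bt * B (gradOf h A) bt := by
      rw [apply_eq_sum (B (gradOf h A)) (gradOf h A)]
      rfl
    have e2 : heightL m (gradOf h A) = h ^ 2 * A (bx (Fin.last m)) := rfl
    rw [e1]
    simp only [add_apply, smul_apply,
      sum_apply, smul_eq_mul, e2, ContinuousLinearMap.flip_apply]
    have e3 : ∑ i, h ^ 2 * A (bx i) * B (gradOf h A) (bx i)
        = h ^ 2 * ∑ i, A (bx i) * B (gradOf h A) (bx i) := by
      rw [Finset.mul_sum]; exact Finset.sum_congr rfl fun i _ => by ring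
    rw [e3]
    ring
  have hSq := hN'.sqrt hW.ne'
  set W := √(normSqOf h A) with hWdef
  have hWpos : 0 < W := Real.sqrt_pos.2 hW
  have hWsq : W ^ 2 = normSqOf h A := Real.sq_sqrt hW.le
  have hevh : ∀ᶠ y in 𝓝 P, height y.1 ≠ 0 :=
    hH.continuousAt.eventually_ne (by rw [← hh]; exact hP.ne')
  -- the common scalar factor
  have hG : HasFDerivAt (fun y => gradNorm f y) ((1 / (2 * W)) • N') P :=
    hSq.congr_of_eventuallyEq (hevh.mono fun y hy => gradNorm_eq f hy)
  have hGP : gradNorm f P = W := gradNorm_eq f (by rw [← hh]; exact hP.ne')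
  have hμ : HasFDerivAt (fun y => volDensity y * (gradNorm f y)⁻¹)
      (-((h ^ (m + 1) * W)⁻¹) • ((((m : ℝ) + 1) / h) • heightL m
        + (1 / (2 * W ^ 2)) • N')) P := by
    have h1 := (hH.pow (m + 1)).fun_mul hG
    have h2 := (hasDerivAt_inv (x := height P.1 ^ (m + 1) * gradNorm f P)
      (by rw [hGP, ← hh]; positivity)).comp_hasFDerivAt P h1
    have h3 : (fun y : Coord m × ℝ => volDensity y * (gradNorm f y)⁻¹)
        = (fun x : ℝ => x⁻¹) ∘ fun y => height y.1 ^ (m + 1) * gradNorm f y := by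
      ext y; simp [volDensity, mul_comm]
    rw [h3]
    refine h2.congr_fderiv ?_
    refine ContinuousLinearMap.ext fun w => ?_
    simp only [add_apply, smul_apply, smul_eq_mul,
      hGP, ← hh, nsmul_eq_mul]
    simp only [Nat.add_one_sub_one]
    push_cast
    field_simp
    ring
  set μ : Coord m × ℝ → ℝ := fun y => volDensity y * (gradNorm f y)⁻¹ with hμdef
  have hμP : μ P = (h ^ (m + 1) * W)⁻¹ := by
    simp only [hμdef, hGP, volDensity, ← hh]; rw [mul_inv]
  have hZi : ∀ i, HasFDerivAt (fun y => (grad f y).1 i)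
      (h ^ 2 • B.flip (bx i) + (2 * h * A (bx i)) • heightL m) P := fun i => by
    refine ((hH.pow 2).fun_mul (hDv (bx i))).congr_fderiv ?_
    refine ContinuousLinearMap.ext fun w => ?_
    simp only [add_apply, smul_apply, smul_eq_mul,
      ← hh, nsmul_eq_mul, ← hAdef]
    simp
    ring
  have hZt : HasFDerivAt (fun y => (grad f y).2) (B.flip bt) P := hDv bt
  have f1 : ∀ i, fderiv ℝ (fun y => volDensity y * ((gradNorm f y)⁻¹ • grad f y).1 i) P
      (EuclideanSpace.single i 1, 0) =
      μ P * (h ^ 2 * B (bx i) (bx i) + 2 * h * A (bx i) * heightL m (bx i))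
      + (grad f P).1 i * fderiv ℝ μ P (EuclideanSpace.single i 1, 0) := fun i => by
    have e : (fun y => volDensity y * ((gradNorm f y)⁻¹ • grad f y).1 i)
        = fun y => μ y * (grad f y).1 i := by
      ext y; simp [hμdef, mul_assoc]
    rw [e, (hμ.fun_mul (hZi i)).fderiv, hμ.fderiv]
    rfl
  have f2 : fderiv ℝ (fun y => volDensity y * ((gradNorm f y)⁻¹ • grad f y).2) P (0, 1) =
      μ P * B bt bt + (grad f P).2 * fderiv ℝ μ P (0, 1) := by
    have e : (fun y => volDensity y * ((gradNorm f y)⁻¹ • grad f y).2)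
        = fun y => μ y * (grad f y).2 := by
      ext y; simp [hμdef, mul_assoc]
    rw [e, (hμ.fun_mul hZt).fderiv, hμ.fderiv]
    rfl
  have f3 : ∑ i, A (bx i) * heightL m (bx i) = A (bx (Fin.last m)) := by
    rw [Finset.sum_eq_single (Fin.last m)]
    · simp [heightL_apply, height, bx]
    · intro i _ hi
      simp [heightL_apply, height, bx, hi.symm]
    · simp
  have hdiv : divergence (fun y => (gradNorm f y)⁻¹ • grad f y) P
      = mcNum h A B / W ^ 3 := by
    rw [divergence]
    simp only [f1, f2]
    have e1 : ∑ i, (μ P * (h ^ 2 * B (bx i) (bx i) + 2 * h * A (bx i) * heightL m (bx i))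
        + (grad f P).1 i * fderiv ℝ μ P (EuclideanSpace.single i 1, 0))
        = μ P * (h ^ 2 * ∑ i, B (bx i) (bx i) + 2 * h * A (bx (Fin.last m)))
          + ∑ i, (grad f P).1 i * fderiv ℝ μ P (EuclideanSpace.single i 1, 0) := by
      rw [Finset.sum_add_distrib, ← Finset.mul_sum, Finset.sum_add_distrib, ← Finset.mul_sum, ← f3,
        Finset.mul_sum (a := 2 * h)]
      simp only [mul_assoc]
    have e2 : ∑ i, (grad f P).1 i * fderiv ℝ μ P (EuclideanSpace.single i 1, 0)
        + (grad f P).2 * fderiv ℝ μ P (0, 1) = fderiv ℝ μ P (gradOf h A) :=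
      sum_fderiv_single _ _
    have e3 : fderiv ℝ μ P (gradOf h A) = -((h ^ (m + 1) * W)⁻¹) *
        (((m : ℝ) + 1) / h * (h ^ 2 * A (bx (Fin.last m))) + (1 / (2 * W ^ 2)) *
          (2 * (h ^ 3 * A (bx (Fin.last m)) * ∑ i, A (bx i) ^ 2
        + B (gradOf h A) (gradOf h A)))) := by
      rw [hμ.fderiv, ← hNZ]; rfl
    rw [e1]
    have e4 : ∀ a b c d : ℝ, a + b + (c + d) = a + c + (b + d) := by intros; ring
    rw [e4, e2, e3, hμP, volDensity, ← hh, mcNum, mcSecond, ← hWsq]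
    field_simp
    ring
  rw [levelMeanCurvature, hdiv]

/-! ### Independence of the defining function -/

/-- A symmetric form vanishing on the diagonal of `ker A` satisfies `S(v, v) = A(v) β(v)` for a
linear `β`. Its metric trace is `β(Z)` with `Z` the gradient, while `S(Z, Z) = |Z|² β(Z)`, so the
two terms of `mcSecond` cancel. -/
theorem mcSecond_eq_zero {m : ℕ} {h : ℝ} (hh : 0 < h) {A : Coord m × ℝ →L[ℝ] ℝ} (hA : A ≠ 0)
    {S : Coord m × ℝ →L[ℝ] Coord m × ℝ →L[ℝ] ℝ} (hsymm : ∀ v w, S v w = S w v)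
    (hS : ∀ v, A v = 0 → S v v = 0) : mcSecond h A S = 0 := by
  have hW := normSqOf_pos hh hA
  set Z := gradOf h A with hZ
  have hAZ : A Z = normSqOf h A := apply_gradOf h A
  set N : Coord m × ℝ := (normSqOf h A)⁻¹ • Z with hN
  have hAN : A N = 1 := by
    rw [hN, map_smul, hAZ, smul_eq_mul, inv_mul_cancel₀ hW.ne']
  set β : Coord m × ℝ →L[ℝ] ℝ := (2 : ℝ) • S N - S N N • A with hβ
  have hSv : ∀ v, S v v = A v * β v := fun v => by
    have h1 := hS (v - A v • N) (by simp [hAN])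
    simp only [map_sub, map_smul, sub_apply, smul_apply,
      smul_eq_mul, hsymm v N] at h1
    simp only [hβ, sub_apply, smul_apply, smul_eq_mul]
    linarith
  have hβZ : β Z = h ^ 2 * ∑ i, A (bx i) * β (bx i) + A bt * β bt := by
    rw [apply_eq_sum β Z, Finset.mul_sum]
    congr 1
    exact Finset.sum_congr rfl fun i _ => by simp [hZ, gradOf]; ring
  rw [mcSecond, ← hZ, hSv Z, hAZ]
  simp only [hSv]
  rw [← hβZ]
  ring

theorem gradOf_smul {m : ℕ} (h l : ℝ) (A : Coord m × ℝ →L[ℝ] ℝ) :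
    gradOf h (l • A) = l • gradOf h A := by
  ext i
  · simp [gradOf]; ring
  · simp [gradOf]

theorem normSqOf_smul {m : ℕ} (h l : ℝ) (A : Coord m × ℝ →L[ℝ] ℝ) :
    normSqOf h (l • A) = l ^ 2 * normSqOf h A := by
  simp only [normSqOf, smul_apply, smul_eq_mul, mul_pow, ← Finset.mul_sum]
  ring

/-- The mean curvature numerator only depends on the differential and on the second differential
along its kernel. -/
theorem mcNum_smul {m : ℕ} {h l : ℝ} (hh : 0 < h) (hl : l ≠ 0) {A : Coord m × ℝ →L[ℝ] ℝ}
    (hA : A ≠ 0) {B B' : Coord m × ℝ →L[ℝ] Coord m × ℝ →L[ℝ] ℝ}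
    (hB : ∀ v w, B v w = B w v) (hB' : ∀ v w, B' v w = B' w v)
    (hS : ∀ v, A v = 0 → B' v v = l * B v v) :
    mcNum h (l • A) B' = l ^ 3 * mcNum h A B := by
  -- `mcSecond` is linear in its second-order argument, and `B' - l • B` vanishes on the diagonal of
  -- the kernel.
  have h0 : mcSecond h (l • A) (B' - l • B) = 0 := by
    refine mcSecond_eq_zero hh (smul_ne_zero hl hA) (fun v w => ?_) fun v hv => ?_
    · simp [hB v w, hB' v w]
    · have : A v = 0 := by simpa [hl] using hv
      simp [hS v this]
  have h1 : mcSecond h (l • A) B' = l ^ 3 * mcSecond h A B := by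
    have h2 : mcSecond h (l • A) B' = mcSecond h (l • A) (B' - l • B)
        + l * mcSecond h (l • A) B := by
      simp only [mcSecond, sub_apply, smul_apply, smul_eq_mul, Finset.sum_sub_distrib,
        ← Finset.mul_sum]
      ring
    rw [h2, h0]
    simp only [mcSecond, gradOf_smul, normSqOf_smul, map_smul, smul_apply, smul_eq_mul]
    ring
  simp only [mcNum, h1, normSqOf_smul, smul_apply, smul_eq_mul, mul_pow, ← Finset.mul_sum]
  ring

theorem second_fderiv_symm {m : ℕ} {f : Coord m × ℝ → ℝ} {P : Coord m × ℝ}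
    (hf : ContDiffAt ℝ 2 f P) (v w : Coord m × ℝ) :
    fderiv ℝ (fderiv ℝ f) P v w = fderiv ℝ (fderiv ℝ f) P w v :=
  (hf.isSymmSndFDerivAt (by simp)).eq v w

theorem fderiv_comp_eq_zero {m : ℕ} {f : Coord m × ℝ → ℝ} {Ψ : Coord m → Coord m × ℝ}
    {w : Coord m} (hΨ : ContDiffAt ℝ 2 Ψ w) (hf : ContDiffAt ℝ 2 f (Ψ w))
    (h0 : ∀ᶠ v in 𝓝 w, f (Ψ v) = 0) (v : Coord m) : fderiv ℝ f (Ψ w) (fderiv ℝ Ψ w v) = 0 := by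
  have h1 : HasFDerivAt (f ∘ Ψ) ((fderiv ℝ f (Ψ w)).comp (fderiv ℝ Ψ w)) w :=
    (hf.differentiableAt (by norm_num)).hasFDerivAt.comp w
      (hΨ.differentiableAt (by norm_num)).hasFDerivAt
  have h2 : HasFDerivAt (f ∘ Ψ) (0 : Coord m →L[ℝ] ℝ) w :=
    (hasFDerivAt_const (0 : ℝ) w).congr_of_eventuallyEq h0
  exact DFunLike.congr_fun (h1.unique h2) v

/-- The relation `f ∘ Ψ = 0`, differentiated twice in the direction `v`. On tangent vectors the
Hessian of `f` is thus determined by `df` and `Ψ`, so proportional differentials have Hessians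
proportional there by the same factor. -/
theorem second_fderiv_comp_eq_zero {m : ℕ} {f : Coord m × ℝ → ℝ} {Ψ : Coord m → Coord m × ℝ}
    {w : Coord m} (hΨ : ContDiffAt ℝ 2 Ψ w) (hf : ContDiffAt ℝ 2 f (Ψ w))
    (h0 : ∀ᶠ v in 𝓝 w, f (Ψ v) = 0) (v : Coord m) :
    fderiv ℝ (fderiv ℝ f) (Ψ w) (fderiv ℝ Ψ w v) (fderiv ℝ Ψ w v)
      = -fderiv ℝ f (Ψ w) (fderiv ℝ (fderiv ℝ Ψ) w v v) := by
  have hev : ∀ᶠ z in 𝓝 w, fderiv ℝ f (Ψ z) (fderiv ℝ Ψ z v) = 0 := by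
    have h1 : ∀ᶠ z in 𝓝 w, ContDiffAt ℝ 2 Ψ z := hΨ.eventually (by simp)
    have h2 : ∀ᶠ z in 𝓝 w, ContDiffAt ℝ 2 f (Ψ z) :=
      hΨ.continuousAt.eventually (hf.eventually (by simp))
    filter_upwards [h1, h2, h0.eventually_nhds] with z h1 h2 h3
    exact fderiv_comp_eq_zero h1 h2 h3 v
  have hDf : HasFDerivAt (fderiv ℝ f) (fderiv ℝ (fderiv ℝ f) (Ψ w)) (Ψ w) :=
    ((hf.fderiv_right (m := 1) (by norm_num)).differentiableAt (by norm_num)).hasFDerivAt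
  have hDΨ : HasFDerivAt (fderiv ℝ Ψ) (fderiv ℝ (fderiv ℝ Ψ) w) w :=
    ((hΨ.fderiv_right (m := 1) (by norm_num)).differentiableAt (by norm_num)).hasFDerivAt
  have h1 := (hDf.comp w (hΨ.differentiableAt (by norm_num)).hasFDerivAt).clm_apply
    (hDΨ.clm_apply (hasFDerivAt_const v w))
  have h2 : HasFDerivAt (fun z => fderiv ℝ f (Ψ z) (fderiv ℝ Ψ z v)) (0 : Coord m →L[ℝ] ℝ) w :=
    (hasFDerivAt_const (0 : ℝ) w).congr_of_eventuallyEq hev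
  have h3 := DFunLike.congr_fun (h1.unique h2) v
  simp at h3
  linarith

/-- Squaring removes both the square root in `|∇f|³` and the sign that depends on the choice between
`f` and `-f`. What remains is polynomial in the derivatives, as the complexification below requires.
-/
theorem mul_levelMeanCurvature_sq {m : ℕ} {f : Coord m × ℝ → ℝ} {P : Coord m × ℝ}
    (hf : ContDiffAt ℝ 2 f P) (hP : 0 < height P.1) (hA : fderiv ℝ f P ≠ 0) :
    (((m : ℝ) + 1) * levelMeanCurvature f P) ^ 2 * normSqOf (height P.1) (fderiv ℝ f P) ^ 3 =
      mcNum (height P.1) (fderiv ℝ f P) (fderiv ℝ (fderiv ℝ f) P) ^ 2 := by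
  have hW := normSqOf_pos hP hA
  rw [levelMeanCurvature_eq hf hP hA]
  have hm : (m : ℝ) + 1 ≠ 0 := by positivity
  have hs : √(normSqOf (height P.1) (fderiv ℝ f P)) ^ 2 = normSqOf (height P.1) (fderiv ℝ f P) :=
    Real.sq_sqrt hW.le
  have hs' := (Real.sqrt_pos.2 hW).ne'
  generalize √(normSqOf (height P.1) (fderiv ℝ f P)) = W at hs hs'
  rw [← hs]
  field_simp

/-- Two functions vanishing on the same hypersurface determine the same squared mean curvature. -/
theorem mcNum_sq_of_vanish {m : ℕ} {f G : Coord m × ℝ → ℝ} {Ψ : Coord m → Coord m × ℝ}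
    {w : Coord m} (hΨ : ContDiffAt ℝ 2 Ψ w) (hinj : Function.Injective (fderiv ℝ Ψ w))
    (hP : 0 < height (Ψ w).1)
    (hf : ContDiffAt ℝ 2 f (Ψ w)) (hA : fderiv ℝ f (Ψ w) ≠ 0) (hf0 : ∀ᶠ v in 𝓝 w, f (Ψ v) = 0)
    (hG : ContDiffAt ℝ 2 G (Ψ w)) (hAG : fderiv ℝ G (Ψ w) ≠ 0) (hG0 : ∀ᶠ v in 𝓝 w, G (Ψ v) = 0) :
    (((m : ℝ) + 1) * levelMeanCurvature f (Ψ w)) ^ 2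
        * normSqOf (height (Ψ w).1) (fderiv ℝ G (Ψ w)) ^ 3 =
      mcNum (height (Ψ w).1) (fderiv ℝ G (Ψ w)) (fderiv ℝ (fderiv ℝ G) (Ψ w)) ^ 2 := by
  set D := fderiv ℝ Ψ w with hD
  have hAD := fderiv_comp_eq_zero hΨ hf hf0
  have hGD := fderiv_comp_eq_zero hΨ hG hG0
  have hBD := second_fderiv_comp_eq_zero hΨ hf hf0
  have hBGD := second_fderiv_comp_eq_zero hΨ hG hG0
  rw [← hD] at hAD hGD hBD hBGD
  set A := fderiv ℝ f (Ψ w) with hAdef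
  set A' := fderiv ℝ G (Ψ w) with hA'def
  -- the image of the differential is the kernel of `A'`
  have hker : LinearMap.range D.toLinearMap = LinearMap.ker A'.toLinearMap := by
    refine Submodule.eq_of_le_of_finrank_le ?_ ?_
    · rintro _ ⟨v, rfl⟩
      exact hGD v
    · have h1 : Module.finrank ℝ (LinearMap.range D.toLinearMap) = m + 1 := by
        rw [LinearMap.finrank_range_of_inj hinj]; simp
      have h2 := LinearMap.finrank_range_add_finrank_ker A'.toLinearMap
      have h3 : LinearMap.range A'.toLinearMap = ⊤ := by
        apply LinearMap.range_eq_top.2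
        apply LinearMap.surjective
        intro h
        exact hAG (ContinuousLinearMap.coe_injective h)
      rw [h3] at h2
      simp at h2
      rw [h1]; omega
  obtain ⟨N, hN⟩ : ∃ N, A' N ≠ 0 := by
    by_contra! h
    exact hAG (ContinuousLinearMap.ext h)
  have hzero : ∀ v, A' v = 0 → ∃ u, D u = v := fun v hv => by
    have : v ∈ LinearMap.range D.toLinearMap := by rw [hker]; exact hv
    exact this
  -- Both differentials vanish on the range of `D`, which is the whole kernel of `A'`; the factor is
  -- read off on the transversal vector `N`.
  have hl : A = (A N / A' N) • A' := by
    refine ContinuousLinearMap.ext fun v => ?_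
    obtain ⟨u, hu⟩ := hzero (v - (A' v / A' N) • N) (by simp [hN])
    have := hAD u
    rw [hu] at this
    simp at this
    simp
    field_simp at this ⊢
    linarith
  set l := A N / A' N with hldef
  have hl0 : l ≠ 0 := by
    intro h
    rw [h, zero_smul] at hl
    exact hA hl
  have key := mul_levelMeanCurvature_sq hf hP hA
  rw [← hAdef, hl, normSqOf_smul, mcNum_smul (B := fderiv ℝ (fderiv ℝ G) (Ψ w)) hP hl0 hAG
    (second_fderiv_symm hG) (second_fderiv_symm hf)] at key
  · have h6 : l ^ 6 ≠ 0 := by positivity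
    apply mul_left_cancel₀ h6
    linear_combination key
  · intro v hv
    obtain ⟨u, rfl⟩ := hzero v hv
    rw [hBD u, hBGD u, hl]
    simp

/-- The parametrized hypersurface `Ψ` has mean curvature `H` near `w`. -/
def HasMeanCurvatureNear {m : ℕ} (Ψ : Coord m → Coord m × ℝ) (H : ℝ) (w : Coord m) : Prop :=
  ∃ (U : Set (Coord m × ℝ)) (f : Coord m × ℝ → ℝ),
    IsOpen U ∧ Ψ w ∈ U ∧ ContDiffOn ℝ ∞ f U ∧ (∀ y ∈ U, fderiv ℝ f y ≠ 0) ∧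
      ∀ᶠ v in 𝓝 w, f (Ψ v) = 0 ∧ levelMeanCurvature f (Ψ v) = H

theorem HasMeanCurvatureNear.mcNum_sq {m : ℕ} {G : Coord m × ℝ → ℝ} {Ψ : Coord m → Coord m × ℝ}
    {w : Coord m} {H : ℝ} (hH : HasMeanCurvatureNear Ψ H w)
    (hΨ : ContDiffAt ℝ 2 Ψ w) (hinj : Function.Injective (fderiv ℝ Ψ w))
    (hP : 0 < height (Ψ w).1) (hG : ContDiffAt ℝ 2 G (Ψ w)) (hAG : fderiv ℝ G (Ψ w) ≠ 0)
    (hG0 : ∀ᶠ v in 𝓝 w, G (Ψ v) = 0) :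
    (((m : ℝ) + 1) * H) ^ 2 * normSqOf (height (Ψ w).1) (fderiv ℝ G (Ψ w)) ^ 3 =
      mcNum (height (Ψ w).1) (fderiv ℝ G (Ψ w)) (fderiv ℝ (fderiv ℝ G) (Ψ w)) ^ 2 := by
  obtain ⟨U, f, hU, hwU, hf, hdf, hev⟩ := hH
  have h2 : (2 : WithTop ℕ∞) ≤ ∞ := WithTop.coe_le_coe.2 le_top
  rw [← hev.self_of_nhds.2]
  exact mcNum_sq_of_vanish hΨ hinj hP ((hf.contDiffAt (hU.mem_nhds hwU)).of_le h2)
    (hdf _ hwU) (hev.mono fun v hv => hv.1) hG hAG hG0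

/-! ### Complexified trigonometric identities -/

/-- The hypothesis makes `X + iY` and `X - iY` mutually inverse, so a logarithm of the first gives
`z` with `exp (iz) = X + iY` and `exp (-iz) = X - iY`. -/
theorem exists_cos_sin_eq {X Y : ℂ} (h : X ^ 2 + Y ^ 2 = 1) :
    ∃ z : ℂ, Complex.cos z = X ∧ Complex.sin z = Y := by
  have h1 : (X + Y * Complex.I) * (X - Y * Complex.I) = 1 := by
    linear_combination h - Y ^ 2 * Complex.I_sq
  have h2 : X + Y * Complex.I ≠ 0 := left_ne_zero_of_mul_eq_one h1
  obtain ⟨u, hu⟩ : ∃ u, Complex.exp u = X + Y * Complex.I := ⟨_, Complex.exp_log h2⟩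
  have hI := Complex.I_sq
  refine ⟨-u * Complex.I, ?_, ?_⟩
  all_goals
    have e1 : Complex.exp (-u * Complex.I * Complex.I) = X + Y * Complex.I := by
      rw [← hu]; congr 1; linear_combination -u * hI
    have e2 : Complex.exp (-(-u * Complex.I) * Complex.I) = X - Y * Complex.I := by
      have : -(-u * Complex.I) * Complex.I = -u := by linear_combination u * hI
      rw [this, Complex.exp_neg, hu]
      exact inv_eq_of_mul_eq_one_right h1
  · rw [Complex.cos, e1, e2]; ring
  · rw [Complex.sin, e1, e2]; linear_combination -Y * hI

theorem eq_zero_of_eventually_real {g : ℂ → ℂ} (hg : Differentiable ℂ g)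
    (h : ∀ᶠ x : ℝ in 𝓝 0, g x = 0) : g = 0 := by
  have ha : AnalyticOnNhd ℂ g Set.univ := fun z _ => hg.analyticAt z
  have hfreq : ∃ᶠ z in 𝓝[≠] (0 : ℂ), g z = 0 := by
    have h1 : Filter.Tendsto (fun x : ℝ => (x : ℂ)) (𝓝[≠] 0) (𝓝[≠] 0) := by
      refine tendsto_nhdsWithin_iff.2 ⟨?_, ?_⟩
      · exact (Complex.continuous_ofReal.tendsto' 0 0 (by simp)).mono_left nhdsWithin_le_nhds
      · filter_upwards [self_mem_nhdsWithin] with x hx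
        simpa using hx
    exact h1.frequently (h.filter_mono nhdsWithin_le_nhds).frequently
  exact ha.eq_of_frequently_eq (fun z _ => analyticAt_const) hfreq

/-- Two complex affine functions of `(cos, sin)`, the second vanishing at the (nonreal) zeros of
the first, are proportional. -/
theorem proportional_of_zeros {k a b α β d : ℝ} (hk : a ^ 2 + b ^ 2 < k ^ 2)
    (hab0 : 0 < a ^ 2 + b ^ 2)
    (key : ∀ z : ℂ, k + (a * Complex.cos z + b * Complex.sin z) = 0 →
      α * Complex.cos z + β * Complex.sin z + d = 0) :
    k * α = d * a ∧ k * β = d * b := by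
  set A := a ^ 2 + b ^ 2 with hA
  set s := √(k ^ 2 - A) with hs
  have hspos : 0 < s := Real.sqrt_pos.2 (by linarith)
  have hs2 : s ^ 2 = k ^ 2 - A := Real.sq_sqrt (by linarith)
  have hs2c : (s : ℂ) ^ 2 = k ^ 2 - (a ^ 2 + b ^ 2) := by
    have := congrArg (fun x : ℝ => (x : ℂ)) hs2
    rw [hA] at this
    push_cast at this
    exact this
  have hA0 : (a : ℂ) ^ 2 + b ^ 2 ≠ 0 := by exact_mod_cast hab0.ne'
  have hI := Complex.I_sq
  -- The line `aX + bY = -k` meets the complex conic `X² + Y² = 1` in the two points `(-ka + εbsi,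
  -- -kb - εasi)/(a² + b²)` with `ε = ±1`, and both are of the form `(cos z, sin z)`.
  have hsol : ∀ ε : ℂ, ε ^ 2 = 1 →
      α * (-k * a + ε * b * s * Complex.I) + β * (-k * b - ε * a * s * Complex.I)
        + d * (a ^ 2 + b ^ 2) = 0 := by
    intro ε hε
    obtain ⟨X, hX⟩ : ∃ X : ℂ, X * (a ^ 2 + b ^ 2) = -k * a + ε * b * s * Complex.I :=
      ⟨_, div_mul_cancel₀ _ hA0⟩
    obtain ⟨Y, hY⟩ : ∃ Y : ℂ, Y * (a ^ 2 + b ^ 2) = -k * b - ε * a * s * Complex.I :=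
      ⟨_, div_mul_cancel₀ _ hA0⟩
    obtain ⟨z, hc, hsn⟩ := exists_cos_sin_eq (X := X) (Y := Y) (by
      apply mul_left_cancel₀ (pow_ne_zero 2 hA0)
      have : ((a : ℂ) ^ 2 + b ^ 2) ^ 2 * (X ^ 2 + Y ^ 2)
          = (X * (a ^ 2 + b ^ 2)) ^ 2 + (Y * (a ^ 2 + b ^ 2)) ^ 2 := by ring
      rw [this, hX, hY]
      linear_combination (a ^ 2 + b ^ 2) * (ε ^ 2 * s ^ 2 * hI - s ^ 2 * hε - hs2c))
    have h1 := key z (by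
      apply (mul_eq_zero.1 (?_ : (k + (a * Complex.cos z + b * Complex.sin z)) * (a ^ 2 + b ^ 2) = 0)).resolve_right hA0
      rw [hc, hsn]
      linear_combination a * hX + b * hY)
    rw [hc, hsn] at h1
    linear_combination (a ^ 2 + b ^ 2) * h1 - α * hX - β * hY
  have e1 := hsol 1 (by norm_num)
  have e2 := hsol (-1) (by norm_num)
  -- The difference of the two relations makes `(α, β)` parallel to `(a, b)`; their sum then fixes
  -- the factor `d/k`.
  have e3 : ((α : ℂ) * b - β * a) * (s * Complex.I) = 0 := by linear_combination (e1 - e2) / 2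
  have e4 : (α : ℂ) * b - β * a = 0 := by
    have : (s : ℂ) * Complex.I ≠ 0 :=
      mul_ne_zero (by exact_mod_cast hspos.ne') Complex.I_ne_zero
    exact (mul_eq_zero.1 e3).resolve_right this
  have e5 : -(k : ℂ) * (α * a + β * b) + d * (a ^ 2 + b ^ 2) = 0 := by
    linear_combination (e1 + e2) / 2
  have r4 : α * b - β * a = 0 := by exact_mod_cast e4
  have r5 : -k * (α * a + β * b) + d * (a ^ 2 + b ^ 2) = 0 := by exact_mod_cast e5
  constructor
  · apply mul_left_cancel₀ hab0.ne'
    rw [hA]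
    linear_combination k * b * r4 - a * r5
  · apply mul_left_cancel₀ hab0.ne'
    rw [hA]
    linear_combination -k * a * r4 - b * r5

/-- Complexification of an arc of a sphere: the polynomial identity `hid` on a real arc forces a
proportionality between the linear functionals that occur in it. -/
theorem proportional_of_arc_identity {k ρ a b α β d M H γ₀ γ₁ γ₂ : ℝ}
    (hk : 0 < k) (hkρ : ρ < k ^ 2) (hab : a ^ 2 + b ^ 2 ≤ ρ) (hab0 : 0 < a ^ 2 + b ^ 2)
    (hM : H ≠ 0 ∨ M ≠ 1)
    (hid : ∀ᶠ z : ℝ in 𝓝 0, ∀ h φ φt l : ℝ, h = k + (a * Real.cos z + b * Real.sin z) →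
      l = α * Real.cos z + β * Real.sin z → φ = -(l + d) →
      φt = γ₀ + γ₁ * Real.cos z + γ₂ * Real.sin z →
      H ^ 2 * (h ^ 2 * ρ + φ ^ 2) ^ 3 = h ^ 2 * (M * ρ * k * h ^ 2 + (2 * h + (M - 1) * k) * φ ^ 2
        + ρ * h * φt + 2 * h * φ * l) ^ 2) :
    k * α = d * a ∧ k * β = d * b := by
  set h : ℂ → ℂ := fun z => k + (a * Complex.cos z + b * Complex.sin z) with hh
  set l : ℂ → ℂ := fun z => α * Complex.cos z + β * Complex.sin z with hl
  set φ : ℂ → ℂ := fun z => -(l z + d) with hφ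
  set φt : ℂ → ℂ := fun z => γ₀ + γ₁ * Complex.cos z + γ₂ * Complex.sin z with hφt
  set K : ℂ → ℂ := fun z => M * ρ * k * h z ^ 2 + (2 * h z + (M - 1) * k) * φ z ^ 2
        + ρ * h z * φt z + 2 * h z * φ z * l z with hK
  have hd : Differentiable ℂ h := by fun_prop
  have ld : Differentiable ℂ l := by fun_prop
  have φd : Differentiable ℂ φ := by fun_prop
  have φtd : Differentiable ℂ φt := by fun_prop
  have Kd : Differentiable ℂ K := by fun_prop
  have key : ∀ z, h z = 0 → φ z = 0 := by
    by_cases hH : H = 0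
    · have hM' : M ≠ 1 := hM.resolve_left (not_not.2 hH)
      have h0 : K = 0 := by
        refine eq_zero_of_eventually_real Kd ?_
        -- At `z = 0` the height is `k + a`, positive because `a² ≤ ρ < k²`. So `h²` can be
        -- cancelled on a real arc, and `K = 0` there, before passing to complex `z`.
        have hpos : ∀ᶠ z : ℝ in 𝓝 0, 0 < k + (a * Real.cos z + b * Real.sin z) := by
          refine (continuous_const.add (by fun_prop) : Continuous fun z : ℝ =>
            k + (a * Real.cos z + b * Real.sin z)).continuousAt.eventually_const_lt ?_
          simp
          nlinarith [sq_nonneg b]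
        filter_upwards [hid, hpos] with z hz hz'
        have h1 := hz _ _ _ _ rfl rfl rfl rfl
        rw [hH] at h1
        have h2 : (M * ρ * k * (k + (a * Real.cos z + b * Real.sin z)) ^ 2
          + (2 * (k + (a * Real.cos z + b * Real.sin z)) + (M - 1) * k)
            * (-(α * Real.cos z + β * Real.sin z + d)) ^ 2
          + ρ * (k + (a * Real.cos z + b * Real.sin z))
            * (γ₀ + γ₁ * Real.cos z + γ₂ * Real.sin z)
          + 2 * (k + (a * Real.cos z + b * Real.sin z))
            * (-(α * Real.cos z + β * Real.sin z + d)) * (α * Real.cos z + β * Real.sin z)) = 0 := by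
          by_contra hne
          have : (k + (a * Real.cos z + b * Real.sin z)) ^ 2 ≠ 0 := by positivity
          have := mul_ne_zero this (pow_ne_zero 2 hne)
          apply this
          rw [← h1]; ring
        have h3 := congrArg (fun x : ℝ => (x : ℂ)) h2
        simp only [hK, hφ, hφt, hl, hh]
        push_cast at h3
        exact h3
      intro z hz
      have h1 := congrFun h0 z
      simp only [hK, hz] at h1
      have h2 : ((M : ℂ) - 1) * k * φ z ^ 2 = 0 := by
        rw [Pi.zero_apply] at h1
        linear_combination h1
      have h3 : ((M : ℂ) - 1) ≠ 0 := by
        intro h; apply hM'; have : (M : ℂ) = 1 := by linear_combination h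
        exact_mod_cast this
      have h4 : (k : ℂ) ≠ 0 := by exact_mod_cast hk.ne'
      simpa [h3, h4] using h2
    · have h0 : (fun z => (H : ℂ) ^ 2 * (h z ^ 2 * ρ + φ z ^ 2) ^ 3 - h z ^ 2 * K z ^ 2) = 0 := by
        refine eq_zero_of_eventually_real (by fun_prop) ?_
        filter_upwards [hid] with z hz
        have h1 := hz _ _ _ _ rfl rfl rfl rfl
        have h3 := congrArg (fun x : ℝ => (x : ℂ)) h1
        simp only [hK, hφ, hφt, hl, hh]
        push_cast at h3
        exact sub_eq_zero.2 h3
      intro z hz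
      have h1 := congrFun h0 z
      simp only [hz] at h1
      have h2 : (H : ℂ) ^ 2 * φ z ^ 6 = 0 := by
        rw [Pi.zero_apply] at h1
        linear_combination h1
      have h4 : (H : ℂ) ≠ 0 := by exact_mod_cast hH
      simpa [h4] using h2
  refine proportional_of_zeros (hab.trans_lt hkρ) hab0 fun z hz => ?_
  have h1 := key z hz
  simp only [hφ, hl] at h1
  linear_combination -h1

/-! ### Sphere families: smoothness of centers and radii -/

/-- A parametrized immersed hypersurface whose horizontal sections `{ℓ = σ}` lie on spheres with
Euclidean center `c σ` and squared Euclidean radius `ρ σ`, strictly inside the half-space. -/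
structure IsSphereFamily {m : ℕ} (Ψ : Coord m → Coord m × ℝ) (O : Set (Coord m))
    (ℓ : Coord m →L[ℝ] ℝ) (e : Coord m) (c : ℝ → Coord m) (ρ : ℝ → ℝ) : Prop where
  isOpen : IsOpen O
  apply_e : ℓ e = 1
  smooth : ∀ w ∈ O, ContDiffAt ℝ ∞ Ψ w
  inj : ∀ w ∈ O, Function.Injective (fderiv ℝ Ψ w)
  level : ∀ w ∈ O, ∀ w' ∈ O, ℓ w = ℓ w' → (Ψ w).2 = (Ψ w').2
  sphere : ∀ w ∈ O, ‖(Ψ w).1 - c (ℓ w)‖ ^ 2 = ρ (ℓ w)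
  height_pos : ∀ w ∈ O, 0 < height (Ψ w).1
  radius_pos : ∀ w ∈ O, 0 < ρ (ℓ w)
  center_pos : ∀ w ∈ O, 0 < height (c (ℓ w))
  radius_lt : ∀ w ∈ O, ρ (ℓ w) < height (c (ℓ w)) ^ 2

namespace IsSphereFamily

variable {m : ℕ} {Ψ : Coord m → Coord m × ℝ} {O : Set (Coord m)} {ℓ : Coord m →L[ℝ] ℝ}
  {e : Coord m} {c : ℝ → Coord m} {ρ : ℝ → ℝ}

theorem hasFDerivAt (h : IsSphereFamily Ψ O ℓ e c ρ) {w : Coord m} (hw : w ∈ O) :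
    HasFDerivAt Ψ (fderiv ℝ Ψ w) w :=
  ((h.smooth w hw).differentiableAt (by simp)).hasFDerivAt

theorem hasFDerivAt_fst (h : IsSphereFamily Ψ O ℓ e c ρ) {w : Coord m} (hw : w ∈ O) :
    HasFDerivAt (fun z => (Ψ z).1) (fderiv ℝ (fun z => (Ψ z).1) w) w :=
  (((h.smooth w hw).fst).differentiableAt (by simp)).hasFDerivAt

theorem fderiv_fst (h : IsSphereFamily Ψ O ℓ e c ρ) {w : Coord m} (hw : w ∈ O) (v : Coord m) :
    fderiv ℝ (fun z => (Ψ z).1) w v = (fderiv ℝ Ψ w v).1 := by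
  rw [(h.hasFDerivAt hw).fst.fderiv]; rfl

theorem eventually_line (h : IsSphereFamily Ψ O ℓ e c ρ) {w : Coord m} (hw : w ∈ O)
    (v : Coord m) : ∀ᶠ s : ℝ in 𝓝 0, w + s • v ∈ O := by
  have : Continuous fun s : ℝ => w + s • v := by fun_prop
  exact this.continuousAt.eventually_mem (h.isOpen.mem_nhds (by simpa using hw))

theorem fderiv_snd_eq_zero (h : IsSphereFamily Ψ O ℓ e c ρ) {w : Coord m} (hw : w ∈ O)
    {v : Coord m} (hv : ℓ v = 0) : (fderiv ℝ Ψ w v).2 = 0 := by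
  have h1 : HasDerivAt (fun s : ℝ => (Ψ (w + s • v)).2) (fderiv ℝ Ψ w v).2 0 := by
    have h2 : HasFDerivAt Ψ (fderiv ℝ Ψ w) (w + (0 : ℝ) • v) := by simpa using h.hasFDerivAt hw
    have h3 : HasDerivAt (fun s : ℝ => w + s • v) v 0 := by
      simpa using ((hasDerivAt_id (0 : ℝ)).smul_const v).const_add w
    exact h2.snd.comp_hasDerivAt (0 : ℝ) h3
  have h4 : HasDerivAt (fun s : ℝ => (Ψ (w + s • v)).2) 0 0 := by
    refine (hasDerivAt_const (0 : ℝ) (Ψ w).2).congr_of_eventuallyEq ?_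
    filter_upwards [h.eventually_line hw v] with s hs
    exact h.level _ hs _ hw (by simp [hv])
  exact h1.unique h4

theorem fderiv_fst_ne_zero (h : IsSphereFamily Ψ O ℓ e c ρ) {w : Coord m} (hw : w ∈ O)
    {v : Coord m} (hv : ℓ v = 0) (hv0 : v ≠ 0) : fderiv ℝ (fun z => (Ψ z).1) w v ≠ 0 := by
  rw [h.fderiv_fst hw]
  intro h0
  apply hv0
  apply h.inj w hw
  rw [map_zero]
  exact Prod.ext h0 (h.fderiv_snd_eq_zero hw hv)

theorem inner_fderiv (h : IsSphereFamily Ψ O ℓ e c ρ) {w : Coord m} (hw : w ∈ O)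
    {v : Coord m} (hv : ℓ v = 0) :
    inner ℝ ((Ψ w).1 - c (ℓ w)) (fderiv ℝ (fun z => (Ψ z).1) w v) = 0 := by
  have h2 : HasFDerivAt (fun z => (Ψ z).1) (fderiv ℝ (fun z => (Ψ z).1) w) (w + (0 : ℝ) • v) := by
    simpa using h.hasFDerivAt_fst hw
  have h3 : HasDerivAt (fun s : ℝ => w + s • v) v 0 := by
    simpa using ((hasDerivAt_id (0 : ℝ)).smul_const v).const_add w
  have h1 := ((h2.comp_hasDerivAt (0 : ℝ) h3).sub_const (c (ℓ w))).norm_sq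
  have h4 : HasDerivAt (fun s : ℝ => ‖(Ψ (w + s • v)).1 - c (ℓ w)‖ ^ 2) 0 0 := by
    refine (hasDerivAt_const (0 : ℝ) (ρ (ℓ w))).congr_of_eventuallyEq ?_
    filter_upwards [h.eventually_line hw v] with s hs
    have := h.sphere _ hs
    rwa [map_add, map_smul, hv, smul_zero, add_zero] at this
  have h5 := h1.unique h4
  simpa using h5

/-- Second derivative of the sphere equation along the section. It makes `D²Y(v, v)`, with `Y` the
horizontal part of `Ψ`, transversal to the sphere, so that vector can complete the tangent space to
a frame. -/
theorem inner_second_fderiv (h : IsSphereFamily Ψ O ℓ e c ρ) {w : Coord m} (hw : w ∈ O)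
    {v : Coord m} (hv : ℓ v = 0) :
    inner ℝ ((Ψ w).1 - c (ℓ w)) (fderiv ℝ (fderiv ℝ (fun z => (Ψ z).1)) w v v)
      = -‖fderiv ℝ (fun z => (Ψ z).1) w v‖ ^ 2 := by
  have h2 := h.hasFDerivAt_fst hw
  have hD : HasFDerivAt (fderiv ℝ (fun z => (Ψ z).1)) (fderiv ℝ (fderiv ℝ (fun z => (Ψ z).1)) w)
      w := by
    have : ContDiffAt ℝ 1 (fderiv ℝ (fun z => (Ψ z).1)) w :=
      (h.smooth w hw).fst.fderiv_right (by exact WithTop.coe_le_coe.2 le_top)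
    exact (this.differentiableAt (by norm_num)).hasFDerivAt
  have h6 : ∀ᶠ s : ℝ in 𝓝 0, inner ℝ ((Ψ (w + s • v)).1 - c (ℓ w))
      (fderiv ℝ (fun z => (Ψ z).1) (w + s • v) v) = 0 := by
    filter_upwards [h.eventually_line hw v] with s hs
    have := h.inner_fderiv hs hv
    rwa [map_add, map_smul, hv, smul_zero, add_zero] at this
  generalize fderiv ℝ (fderiv ℝ (fun z => (Ψ z).1)) w = D₂ at hD ⊢
  generalize fderiv ℝ (fun z => (Ψ z).1) = D at h2 hD h6 ⊢
  generalize c (ℓ w) = C at h6 ⊢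
  have h3 : HasDerivAt (fun s : ℝ => w + s • v) v 0 := by
    simpa using ((hasDerivAt_id (0 : ℝ)).smul_const v).const_add w
  have hw0 : w = w + (0 : ℝ) • v := by simp
  rw [hw0] at h2 hD
  have h7 : HasDerivAt (fun s : ℝ => (Ψ (w + s • v)).1 - C) (D w v) 0 := by
    have := (h2.comp_hasDerivAt (0 : ℝ) h3).sub_const C
    rwa [← hw0] at this
  have h8 : HasDerivAt (fun s : ℝ => D (w + s • v) v) (D₂ v v) 0 := by
    have h9 : HasFDerivAt (fun z => D z v) (D₂.flip v) (w + (0 : ℝ) • v) := by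
      have := hD.clm_apply (hasFDerivAt_const v (w + (0 : ℝ) • v))
      refine this.congr_fderiv (ContinuousLinearMap.ext fun u => ?_)
      simp
    have h10 : HasDerivAt (fun s : ℝ => D (w + s • v) v) (D₂.flip v v) 0 :=
      HasFDerivAt.comp_hasDerivAt (l := fun z => D z v) (0 : ℝ) h9 h3
    rwa [ContinuousLinearMap.flip_apply] at h10
  have h5 := (h7.inner ℝ h8).unique
    ((hasDerivAt_const (0 : ℝ) (0 : ℝ)).congr_of_eventuallyEq h6)
  rw [← hw0, real_inner_self_eq_norm_sq] at h5
  linarith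

theorem exists_ker_ne_zero (hm : 1 ≤ m) (ℓ : Coord m →L[ℝ] ℝ) : ∃ v, ℓ v = 0 ∧ v ≠ 0 := by
  by_contra! hcon
  have : Function.Injective ℓ.toLinearMap :=
    (injective_iff_map_eq_zero ℓ.toLinearMap).2 fun v hv => hcon v hv
  have := LinearMap.finrank_le_finrank_of_injective this
  simp at this
  omega

/-- An invertible operator built from the derivatives of the hypersurface along a section, which
recovers the center of the sphere containing that section. -/
def frame (Ψ : Coord m → Coord m × ℝ) (ℓ : Coord m →L[ℝ] ℝ) (e v : Coord m) (w : Coord m) :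
    Coord m →L[ℝ] Coord m :=
  (fderiv ℝ (fun z => (Ψ z).1) w).comp (ContinuousLinearMap.id ℝ _ - ℓ.smulRight e)
    + ℓ.smulRight (fderiv ℝ (fderiv ℝ (fun z => (Ψ z).1)) w v v)

/-- The first summand of `frame` is tangent to the sphere and drops out; the second contributes only
through its radial part. The radial vector is thus the solution of a linear system whose
coefficients are derivatives of `Ψ`. -/
theorem inner_frame (h : IsSphereFamily Ψ O ℓ e c ρ) {w : Coord m} (hw : w ∈ O)
    {v : Coord m} (hv : ℓ v = 0) (u : Coord m) :
    inner ℝ ((Ψ w).1 - c (ℓ w)) (frame Ψ ℓ e v w u)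
      = -ℓ u * ‖fderiv ℝ (fun z => (Ψ z).1) w v‖ ^ 2 := by
  have h1 : ℓ (u - ℓ u • e) = 0 := by simp [h.apply_e]
  have h2 := h.inner_fderiv hw h1
  have h3 := h.inner_second_fderiv hw hv
  have h4 : frame Ψ ℓ e v w u = fderiv ℝ (fun z => (Ψ z).1) w (u - ℓ u • e)
      + ℓ u • fderiv ℝ (fderiv ℝ (fun z => (Ψ z).1)) w v v := rfl
  rw [h4, inner_add_right, h2, inner_smul_right, h3]
  ring

theorem frame_injective (h : IsSphereFamily Ψ O ℓ e c ρ) {w : Coord m} (hw : w ∈ O)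
    {v : Coord m} (hv : ℓ v = 0) (hv0 : v ≠ 0) : Function.Injective (frame Ψ ℓ e v w) := by
  refine (injective_iff_map_eq_zero (frame Ψ ℓ e v w)).2 fun u hu => ?_
  have h1 := h.inner_frame hw hv u
  have h2 := h.fderiv_fst_ne_zero hw hv hv0
  rw [hu, inner_zero_right] at h1
  have h3 : ℓ u = 0 := by
    have : ‖fderiv ℝ (fun z => (Ψ z).1) w v‖ ^ 2 ≠ 0 := by positivity
    have h4 := mul_eq_zero.1 h1.symm
    simpa [this] using h4
  by_contra hne
  apply h.fderiv_fst_ne_zero hw h3 hne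
  simpa [frame, h3] using hu

theorem contDiffAt_frame (h : IsSphereFamily Ψ O ℓ e c ρ) {w : Coord m} (hw : w ∈ O)
    (v : Coord m) : ContDiffAt ℝ ∞ (frame Ψ ℓ e v) w := by
  have h1 : ContDiffAt ℝ ∞ (fderiv ℝ (fun z => (Ψ z).1)) w :=
    (h.smooth w hw).fst.fderiv_right (m := ∞) (by simp)
  have h2 : ContDiffAt ℝ ∞ (fderiv ℝ (fderiv ℝ (fun z => (Ψ z).1))) w :=
    h1.fderiv_right (m := ∞) (by simp)
  unfold frame
  refine (h1.clm_comp contDiffAt_const).add ?_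
  exact ContDiffAt.smulRight contDiffAt_const ((h2.clm_apply contDiffAt_const).clm_apply
    contDiffAt_const)

theorem center_apply (h : IsSphereFamily Ψ O ℓ e c ρ) {w : Coord m} (hw : w ∈ O)
    {v : Coord m} (hv : ℓ v = 0) (hv0 : v ≠ 0) (i : Fin (m + 1)) :
    c (ℓ w) i = (Ψ w).1 i + ‖fderiv ℝ (fun z => (Ψ z).1) w v‖ ^ 2
      * ℓ ((frame Ψ ℓ e v w).inverse (EuclideanSpace.single i 1)) := by
  obtain ⟨T, hT⟩ : ∃ T : Coord m ≃L[ℝ] Coord m, (T : Coord m →L[ℝ] Coord m) = frame Ψ ℓ e v w := by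
    refine ⟨(LinearEquiv.ofInjectiveEndo (frame Ψ ℓ e v w).toLinearMap
      (h.frame_injective hw hv hv0)).toContinuousLinearEquiv, ?_⟩
    ext1 u; rfl
  have h1 := h.inner_frame hw hv ((frame Ψ ℓ e v w).inverse (EuclideanSpace.single i 1))
  rw [← hT, ContinuousLinearMap.inverse_equiv] at h1 ⊢
  simp [EuclideanSpace.inner_single_right] at h1
  simp
  linarith

/-- Nothing is assumed about how `c` depends on its parameter. Smoothness comes from `center_apply`,
which expresses `c` through derivatives of `Ψ` and the inverse of the invertible operator `frame`.
-/
theorem contDiffAt_center (hm : 1 ≤ m) (h : IsSphereFamily Ψ O ℓ e c ρ) {σ : ℝ}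
    (hσ : σ • e ∈ O) : ContDiffAt ℝ ∞ c σ := by
  obtain ⟨v, hv, hv0⟩ := exists_ker_ne_zero hm ℓ
  have hline : ContDiffAt ℝ ∞ (fun s : ℝ => s • e) σ := by fun_prop
  have hY : ContDiffAt ℝ ∞ (fun z => (Ψ z).1) (σ • e) := (h.smooth _ hσ).fst
  have hinv : ContDiffAt ℝ ∞ (fun w => (frame Ψ ℓ e v w).inverse) (σ • e) := by
    have h1 : ContDiffAt ℝ ∞ ContinuousLinearMap.inverse (frame Ψ ℓ e v (σ • e)) := by
      have := contDiffAt_map_inverse (𝕜 := ℝ) (n := ∞)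
        (LinearEquiv.ofInjectiveEndo (frame Ψ ℓ e v (σ • e)).toLinearMap
          (h.frame_injective hσ hv hv0)).toContinuousLinearEquiv
      exact this
    exact h1.comp _ (h.contDiffAt_frame hσ v)
  rw [contDiffAt_euclidean]
  intro i
  have h2 : ContDiffAt ℝ ∞ (fun w => (Ψ w).1 i + ‖fderiv ℝ (fun z => (Ψ z).1) w v‖ ^ 2
      * ℓ ((frame Ψ ℓ e v w).inverse (EuclideanSpace.single i 1))) (σ • e) := by
    refine ((contDiffAt_euclidean.1 hY) i).add (ContDiffAt.mul ?_ ?_)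
    · exact ((hY.fderiv_right (m := ∞) (by simp)).clm_apply contDiffAt_const).norm_sq ℝ
    · exact ℓ.contDiff.contDiffAt.comp _ (hinv.clm_apply contDiffAt_const)
  refine (h2.comp σ hline).congr_of_eventuallyEq ?_
  filter_upwards [hline.continuousAt.eventually_mem (h.isOpen.mem_nhds hσ)] with s hs
  have := h.center_apply hs hv hv0 i
  rw [map_smul, h.apply_e, smul_eq_mul, mul_one] at this
  exact this

theorem contDiffAt_radius (hm : 1 ≤ m) (h : IsSphereFamily Ψ O ℓ e c ρ) {σ : ℝ}
    (hσ : σ • e ∈ O) : ContDiffAt ℝ ∞ ρ σ := by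
  have hline : ContDiffAt ℝ ∞ (fun s : ℝ => s • e) σ := by fun_prop
  have hY : ContDiffAt ℝ ∞ (fun z => (Ψ z).1) (σ • e) := (h.smooth _ hσ).fst
  refine (((hY.comp σ hline).sub (h.contDiffAt_center hm hσ)).norm_sq ℝ).congr_of_eventuallyEq ?_
  filter_upwards [hline.continuousAt.eventually_mem (h.isOpen.mem_nhds hσ)] with s hs
  have := h.sphere _ hs
  rw [map_smul, h.apply_e, smul_eq_mul, mul_one] at this
  exact this.symm

/-- The height of the section `{ℓ = σ}`. -/
def slice (Ψ : Coord m → Coord m × ℝ) (e : Coord m) (σ : ℝ) : ℝ := (Ψ (σ • e)).2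

theorem contDiffAt_slice (h : IsSphereFamily Ψ O ℓ e c ρ) {σ : ℝ} (hσ : σ • e ∈ O) :
    ContDiffAt ℝ ∞ (slice Ψ e) σ := by
  have hline : ContDiffAt ℝ ∞ (fun s : ℝ => s • e) σ := by fun_prop
  exact ContDiffAt.comp (g := fun w => (Ψ w).2) σ (h.smooth _ hσ).snd hline

theorem eventually_mem (h : IsSphereFamily Ψ O ℓ e c ρ) {σ : ℝ} (hσ : σ • e ∈ O) :
    ∀ᶠ s : ℝ in 𝓝 σ, s • e ∈ O := by
  have : Continuous fun s : ℝ => s • e := by fun_prop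
  exact this.continuousAt.eventually_mem (h.isOpen.mem_nhds hσ)

theorem eventually_snd (h : IsSphereFamily Ψ O ℓ e c ρ) {σ : ℝ} (hσ : σ • e ∈ O) :
    ∀ᶠ w in 𝓝 (σ • e), w ∈ O ∧ ℓ w • e ∈ O ∧ (Ψ w).2 = slice Ψ e (ℓ w) := by
  have h1 : Continuous fun w => ℓ w • e := by fun_prop
  have h2 : ∀ᶠ w in 𝓝 (σ • e), ℓ w • e ∈ O :=
    h1.continuousAt.eventually_mem (h.isOpen.mem_nhds (by simpa [h.apply_e] using hσ))
  filter_upwards [h.isOpen.mem_nhds hσ, h2] with w hw hw'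
  exact ⟨hw, hw', h.level _ hw _ hw' (by simp [h.apply_e])⟩

end IsSphereFamily

/-! ### Mean curvature of a one-parameter family of horizontal spheres -/

/-- A function whose zero set is the union of the horizontal spheres with Euclidean center `C t`
and squared Euclidean radius `R t` at height `t`. -/
def sphereFun {m : ℕ} (C : ℝ → Coord m) (R : ℝ → ℝ) (y : Coord m × ℝ) : ℝ :=
  (‖y.1 - C y.2‖ ^ 2 - R y.2) / 2

theorem contDiffAt_sphereFun {m : ℕ} {C : ℝ → Coord m} {R : ℝ → ℝ} {x : Coord m} {t : ℝ}
    {k : WithTop ℕ∞} (hC : ContDiffAt ℝ k C t) (hR : ContDiffAt ℝ k R t) :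
    ContDiffAt ℝ k (sphereFun C R) (x, t) := by
  have h1 : ContDiffAt ℝ k (fun y : Coord m × ℝ => C y.2) (x, t) :=
    ContDiffAt.comp (g := C) (x, t) hC contDiffAt_snd
  have h2 : ContDiffAt ℝ k (fun y : Coord m × ℝ => R y.2) (x, t) :=
    ContDiffAt.comp (g := R) (x, t) hR contDiffAt_snd
  unfold sphereFun
  exact (((contDiffAt_fst.sub h1).norm_sq ℝ).sub h2).div_const 2

theorem hasDerivAt_line {m : ℕ} {f : Coord m × ℝ → ℝ} {P : Coord m × ℝ}
    (hf : DifferentiableAt ℝ f P) (v : Coord m × ℝ) :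
    HasDerivAt (fun s : ℝ => f (P + s • v)) (fderiv ℝ f P v) 0 := by
  have h3 : HasDerivAt (fun s : ℝ => P + s • v) v 0 := by
    simpa using ((hasDerivAt_id (0 : ℝ)).smul_const v).const_add P
  have h4 : HasFDerivAt f (fderiv ℝ f P) (P + (0 : ℝ) • v) := by simpa using hf.hasFDerivAt
  exact h4.comp_hasDerivAt (0 : ℝ) h3

theorem hasDerivAt_comp_line {F : Type*} [NormedAddCommGroup F] [NormedSpace ℝ F] {C : ℝ → F}
    {C' : F} {t : ℝ} (hC : HasDerivAt C C' t) (b : ℝ) :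
    HasDerivAt (fun s : ℝ => C (t + s * b)) (b • C') 0 := by
  have h1 : HasDerivAt (fun s : ℝ => t + s * b) b 0 := by
    simpa using ((hasDerivAt_id (0 : ℝ)).mul_const b).const_add t
  have h2 : HasDerivAt C C' (t + 0 * b) := by simpa using hC
  exact h2.scomp (0 : ℝ) h1

theorem contDiffAt_deriv {F : Type*} [NormedAddCommGroup F] [NormedSpace ℝ F] {C : ℝ → F}
    {t : ℝ} {n k : WithTop ℕ∞} (hC : ContDiffAt ℝ n C t) (hk : k + 1 ≤ n) :
    ContDiffAt ℝ k (deriv C) t := by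
  have : deriv C = fun x => fderiv ℝ C x 1 := by ext1 x; simp
  rw [this]
  exact (hC.fderiv_right hk).clm_apply contDiffAt_const

theorem fderiv_sphereFun {m : ℕ} {C : ℝ → Coord m} {R : ℝ → ℝ} {x : Coord m} {t : ℝ}
    (hC : ContDiffAt ℝ 1 C t) (hR : ContDiffAt ℝ 1 R t) (v : Coord m × ℝ) :
    fderiv ℝ (sphereFun C R) (x, t) v =
      inner ℝ (x - C t) (v.1 - v.2 • deriv C t) - v.2 * deriv R t / 2 := by
  have h1 := hasDerivAt_line ((contDiffAt_sphereFun (x := x) hC hR).differentiableAt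
    (by norm_num)) v
  have hC' := hasDerivAt_comp_line (hC.differentiableAt (by norm_num)).hasDerivAt v.2
  have hR' := hasDerivAt_comp_line (hR.differentiableAt (by norm_num)).hasDerivAt v.2
  have hx : HasDerivAt (fun s : ℝ => x + s • v.1) v.1 0 := by
    simpa using ((hasDerivAt_id (0 : ℝ)).smul_const v.1).const_add x
  have h2 := ((hx.fun_sub hC').norm_sq.fun_sub hR').div_const 2
  have h3 := h1.unique h2
  simp only [zero_mul, zero_smul, add_zero, smul_eq_mul] at h3
  rw [h3]
  ring

theorem second_fderiv_sphereFun {m : ℕ} {C : ℝ → Coord m} {R : ℝ → ℝ} {x : Coord m} {t : ℝ}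
    (hC : ContDiffAt ℝ 2 C t) (hR : ContDiffAt ℝ 2 R t) (v : Coord m × ℝ) :
    fderiv ℝ (fderiv ℝ (sphereFun C R)) (x, t) v v =
      ‖v.1 - v.2 • deriv C t‖ ^ 2 - v.2 ^ 2 * inner ℝ (x - C t) (deriv (deriv C) t)
        - v.2 ^ 2 * deriv (deriv R) t / 2 := by
  have hD : DifferentiableAt ℝ (fderiv ℝ (sphereFun C R)) (x, t) :=
    ((contDiffAt_sphereFun (x := x) hC hR).fderiv_right (m := 1) (by norm_num)).differentiableAt
      (by norm_num)
  have h1 := hasDerivAt_line (hD.clm_apply (differentiableAt_const v)) v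
  have h0 : fderiv ℝ (fun y => fderiv ℝ (sphereFun C R) y v) (x, t) v
      = fderiv ℝ (fderiv ℝ (sphereFun C R)) (x, t) v v := by
    have := hD.hasFDerivAt.clm_apply (hasFDerivAt_const v (x, t))
    rw [this.fderiv]; simp
  rw [h0] at h1
  have hC' := hasDerivAt_comp_line (hC.differentiableAt (by norm_num)).hasDerivAt v.2
  have hdC : ContDiffAt ℝ 1 (deriv C) t := contDiffAt_deriv hC (by norm_num)
  have hdR : ContDiffAt ℝ 1 (deriv R) t := contDiffAt_deriv hR (by norm_num)
  have hC'' := hasDerivAt_comp_line (hdC.differentiableAt (by norm_num)).hasDerivAt v.2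
  have hR'' := hasDerivAt_comp_line (hdR.differentiableAt (by norm_num)).hasDerivAt v.2
  have hx : HasDerivAt (fun s : ℝ => x + s • v.1) v.1 0 := by
    simpa using ((hasDerivAt_id (0 : ℝ)).smul_const v.1).const_add x
  have h2 := ((hx.fun_sub hC').inner ℝ ((hasDerivAt_const (0 : ℝ) v.1).fun_sub
    (hC''.const_smul v.2))).fun_sub ((hR''.const_mul v.2).div_const 2)
  have hev : (fun s : ℝ => fderiv ℝ (sphereFun C R) ((x, t) + s • v) v) =ᶠ[𝓝 0]
      fun s => inner ℝ (x + s • v.1 - C (t + s * v.2))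
        (v.1 - v.2 • deriv C (t + s * v.2)) - v.2 * deriv R (t + s * v.2) / 2 := by
    have hl : Continuous fun s : ℝ => t + s * v.2 := by fun_prop
    have e1 : ∀ᶠ s : ℝ in 𝓝 0, ContDiffAt ℝ 2 C (t + s * v.2) :=
      hl.continuousAt.eventually (p := fun y => ContDiffAt ℝ 2 C y)
        (by simpa using hC.eventually (by simp))
    have e2 : ∀ᶠ s : ℝ in 𝓝 0, ContDiffAt ℝ 2 R (t + s * v.2) :=
      hl.continuousAt.eventually (p := fun y => ContDiffAt ℝ 2 R y)
        (by simpa using hR.eventually (by simp))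
    filter_upwards [e1, e2] with s e1 e2
    exact fderiv_sphereFun (x := x + s • v.1) (e1.of_le (by norm_num)) (e2.of_le (by norm_num)) v
  have h3 := (h1.congr_of_eventuallyEq hev.symm).unique h2
  simp only [zero_mul, zero_smul, add_zero, smul_eq_mul, Pi.smul_apply] at h3
  rw [h3, ← real_inner_self_eq_norm_sq]
  simp only [zero_sub, inner_neg_right, inner_smul_right]
  ring

/-- Here `φ` and `φt` are the first and second `t`-derivatives of `sphereFun C R`. On a fixed sphere
`h`, `l`, `φ` and `φt` are affine in `x`, hence affine in cosine and sine along its great circles.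
The common factor `h` of the numerator is what makes the complex zeros of `h` informative. -/
theorem mcNum_sphereFun {m : ℕ} {C : ℝ → Coord m} {R : ℝ → ℝ} {x : Coord m} {t ρ : ℝ}
    (hC : ContDiffAt ℝ 2 C t) (hR : ContDiffAt ℝ 2 R t) (hx : ‖x - C t‖ ^ 2 = ρ)
    {h k φ φt l : ℝ} (hh : height x = h) (hk : height (C t) = k)
    (hl : l = inner ℝ (x - C t) (deriv C t)) (hφ : φ = -(l + deriv R t / 2))
    (hφt : φt = ‖deriv C t‖ ^ 2 - inner ℝ (x - C t) (deriv (deriv C) t)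
      - deriv (deriv R) t / 2) :
    normSqOf h (fderiv ℝ (sphereFun C R) (x, t)) = h ^ 2 * ρ + φ ^ 2 ∧
    mcNum h (fderiv ℝ (sphereFun C R) (x, t)) (fderiv ℝ (fderiv ℝ (sphereFun C R)) (x, t))
      = h * (m * ρ * k * h ^ 2 + (2 * h + (m - 1) * k) * φ ^ 2 + ρ * h * φt + 2 * h * φ * l) := by
  have hA := fderiv_sphereFun (x := x) (hC.of_le (by norm_num)) (hR.of_le (by norm_num))
  have hB := second_fderiv_sphereFun (x := x) hC hR
  set A := fderiv ℝ (sphereFun C R) (x, t)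
  set B := fderiv ℝ (fderiv ℝ (sphereFun C R)) (x, t)
  have hAi : ∀ i, A (bx i) = (x - C t) i := fun i => by
    rw [hA]; simp [bx, EuclideanSpace.inner_single_right]
  have hAt : A bt = φ := by
    rw [hA, hφ, hl]; simp [bt]; ring
  have hsum : ∑ i, A (bx i) ^ 2 = ρ := by
    rw [← hx, EuclideanSpace.real_norm_sq_eq]
    exact Finset.sum_congr rfl fun i _ => by rw [hAi]
  have hN : normSqOf h A = h ^ 2 * ρ + φ ^ 2 := by rw [normSqOf, hsum, hAt]
  refine ⟨hN, ?_⟩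
  have hBi : ∀ i, B (bx i) (bx i) = 1 := fun i => by
    rw [hB]; simp [bx]
  have hBt : B bt bt = φt := by
    rw [hB, hφt]; simp [bt]
  have hZ : gradOf h A = (h ^ 2 • (x - C t), φ) := by
    ext i
    · simp [gradOf, hAi]
    · simp [gradOf, hAt]
  have hBZ : B (gradOf h A) (gradOf h A) = h ^ 4 * ρ - 2 * h ^ 2 * φ * l + φ ^ 2 * φt := by
    rw [hZ, hB, hφt, ← hx, hl]
    simp only
    rw [norm_sub_sq_real, norm_smul, norm_smul, inner_smul_left, inner_smul_right]
    simp only [mul_pow, Real.norm_eq_abs, sq_abs, conj_trivial]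
    ring
  have hlast : A (bx (Fin.last m)) = h - k := by
    rw [hAi, ← hh, ← hk]; rfl
  rw [mcNum, mcSecond, hN, hBZ, hsum, hBt, hlast]
  simp only [hBi]
  simp
  ring

/-! ### Great circles of a sphere in half-space -/

theorem inner_single_last {m : ℕ} (v : Coord m) :
    inner ℝ v (EuclideanSpace.single (Fin.last m) (1 : ℝ)) = height v := by
  simp [EuclideanSpace.inner_single_right, height]

/-- Bessel's inequality for two orthogonal vectors of equal length and the vertical unit vector. -/
theorem height_sq_add_height_sq_le {m : ℕ} {ξ η : Coord m} {ρ : ℝ} (hρ : 0 < ρ)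
    (hξ : ‖ξ‖ ^ 2 = ρ) (hη : ‖η‖ ^ 2 = ρ) (horth : inner ℝ ξ η = 0) :
    height ξ ^ 2 + height η ^ 2 ≤ ρ := by
  set E : Coord m := EuclideanSpace.single (Fin.last m) (1 : ℝ) with hE
  have hE1 : inner ℝ E E = (1 : ℝ) := by
    rw [inner_single_last]; simp [hE, height]
  -- This is `ρ` times the residual of projecting `E` to the span of `ξ` and `η`; its squared norm
  -- is `ρ² - ρ (height ξ ^ 2 + height η ^ 2)`.
  have h0 : 0 ≤ inner ℝ (ρ • E - height ξ • ξ - height η • η)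
    (ρ • E - height ξ • ξ - height η • η) := real_inner_self_nonneg
  have e1 : inner ℝ ξ E = height ξ := inner_single_last ξ
  have e2 : inner ℝ η E = height η := inner_single_last η
  have e3 : inner ℝ E ξ = height ξ := by rw [real_inner_comm, e1]
  have e4 : inner ℝ E η = height η := by rw [real_inner_comm, e2]
  have e5 : inner ℝ η ξ = 0 := by rw [real_inner_comm, horth]
  have e6 : inner ℝ ξ ξ = ρ := by rw [real_inner_self_eq_norm_sq, hξ]
  have e7 : inner ℝ η η = ρ := by rw [real_inner_self_eq_norm_sq, hη]
  simp only [inner_sub_left, inner_sub_right, real_inner_smul_left, real_inner_smul_right,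
    e1, e2, e3, e4, e5, e6, e7, hE1, horth] at h0
  nlinarith

theorem norm_sq_arc {m : ℕ} {ξ η : Coord m} {ρ : ℝ}
    (hξ : ‖ξ‖ ^ 2 = ρ) (hη : ‖η‖ ^ 2 = ρ) (horth : inner ℝ ξ η = 0) (z : ℝ) :
    ‖Real.cos z • ξ + Real.sin z • η‖ ^ 2 = ρ := by
  rw [norm_add_sq_real, norm_smul, norm_smul, real_inner_smul_left, real_inner_smul_right, horth]
  simp only [mul_pow, Real.norm_eq_abs, sq_abs, hξ, hη]
  linear_combination ρ * Real.cos_sq_add_sin_sq z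

theorem exists_orthogonal_ne_zero {m : ℕ} (hm : 1 ≤ m) (ξ : Coord m) :
    ∃ η : Coord m, inner ℝ ξ η = 0 ∧ η ≠ 0 :=
  IsSphereFamily.exists_ker_ne_zero hm (innerSL ℝ ξ)

/-- If `V` is orthogonal to `ξ` and to all `η ⟂ ξ` of the same length as `ξ`, apart from those for
which both `ξ` and `η` are horizontal, then `V = 0`. -/
theorem eq_zero_of_orthogonal {m : ℕ} (hm : 1 ≤ m) {ξ V : Coord m} {ρ : ℝ} (hρ : 0 < ρ)
    (hV : ∀ η : Coord m, ‖η‖ ^ 2 = ρ → inner ℝ ξ η = 0 → 0 < height ξ ^ 2 + height η ^ 2 →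
      inner ℝ ξ V = 0 ∧ inner ℝ η V = 0) : V = 0 := by
  have hscale : ∀ η : Coord m, η ≠ 0 → inner ℝ ξ η = 0 → 0 < height ξ ^ 2 + height η ^ 2 →
      inner ℝ ξ V = 0 ∧ inner ℝ η V = 0 := by
    intro η hη0 hη hpos
    have hn : 0 < ‖η‖ := norm_pos_iff.2 hη0
    set r := √ρ / ‖η‖ with hr
    have hr0 : 0 < r := by positivity
    have hh : height (r • η) = r * height η := rfl
    have h1 := hV (r • η) (by
      rw [norm_smul, mul_pow, Real.norm_eq_abs, sq_abs, hr, div_pow, Real.sq_sqrt hρ.le]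
      field_simp) (by rw [real_inner_smul_right, hη, mul_zero]) (by
      rw [hh, mul_pow]
      by_contra hcon
      have h2 : height ξ ^ 2 + r ^ 2 * height η ^ 2 = 0 := by
        have : 0 ≤ height ξ ^ 2 + r ^ 2 * height η ^ 2 := by positivity
        linarith
      have h3 : height ξ ^ 2 = 0 := by
        nlinarith [sq_nonneg (height ξ), mul_nonneg (sq_nonneg r) (sq_nonneg (height η))]
      have h4 : r ^ 2 * height η ^ 2 = 0 := by linarith
      have h5 : height η ^ 2 = 0 := by
        rcases mul_eq_zero.1 h4 with h | h
        · exact absurd h (by positivity)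
        · exact h
      linarith)
    refine ⟨h1.1, ?_⟩
    have h2 := h1.2
    rw [real_inner_smul_left] at h2
    exact (mul_eq_zero.1 h2).resolve_left hr0.ne'
  by_contra hV0
  -- If `ξ` is horizontal, only non-horizontal `η` are admissible, and `E` followed by `V + E`
  -- serves as a test. Otherwise any `η` orthogonal to `ξ` is admissible, and once `V ⟂ ξ` is known,
  -- `V` tests itself.
  by_cases h0 : height ξ = 0
  · set E : Coord m := EuclideanSpace.single (Fin.last m) (1 : ℝ) with hE
    have hEh : height E = 1 := by simp [hE, height]
    have hE0 : E ≠ 0 := by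
      intro h
      rw [h] at hEh
      simp [height] at hEh
    have e1 : inner ℝ ξ E = 0 := by rw [inner_single_last, h0]
    obtain ⟨h1, h2⟩ := hscale E hE0 e1 (by rw [h0, hEh]; norm_num)
    have h3 : height V = 0 := by rw [← inner_single_last, real_inner_comm, h2]
    have h4 : height (V + E) = 1 := by
      have : height (V + E) = height V + height E := rfl
      rw [this, h3, hEh, zero_add]
    have h5 := (hscale (V + E) (fun h => by rw [h] at h4; simp [height] at h4)
      (by rw [inner_add_right, h1, e1, add_zero]) (by rw [h0, h4]; norm_num)).2
    rw [inner_add_left, h2, add_zero] at h5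
    exact hV0 (inner_self_eq_zero.1 h5)
  · have hpos : ∀ η : Coord m, 0 < height ξ ^ 2 + height η ^ 2 := fun η => by positivity
    obtain ⟨η, hη, hη0⟩ := exists_orthogonal_ne_zero hm ξ
    have h1 := (hscale η hη0 hη (hpos η)).1
    exact hV0 (inner_self_eq_zero.1 (hscale V hV0 h1 (hpos V)).2)

/-! ### The center equation where the leaf height varies -/

namespace IsSphereFamily

variable {m : ℕ} {Ψ : Coord m → Coord m × ℝ} {O : Set (Coord m)} {ℓ : Coord m →L[ℝ] ℝ}
  {e : Coord m} {c : ℝ → Coord m} {ρ : ℝ → ℝ}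

/-- The section of a sphere family is open in its sphere. -/
theorem eventually_exists_section (h : IsSphereFamily Ψ O ℓ e c ρ) {σ : ℝ} (hσ : σ • e ∈ O)
    {p : Coord m → Prop} (hp : ∀ᶠ w in 𝓝 (σ • e), ℓ w = σ → p (Ψ w).1) :
    ∀ᶠ x in 𝓝 (Ψ (σ • e)).1, ‖x - c σ‖ ^ 2 = ρ σ → p x := by
  set w₁ := σ • e with hw₁
  have hℓ₁ : ℓ w₁ = σ := by rw [hw₁, map_smul, h.apply_e, smul_eq_mul, mul_one]
  set Y : Coord m → Coord m := fun z => (Ψ z).1 with hY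
  -- `Θ` is a cone over the section: moving along `e` scales the sphere about its center instead of
  -- changing the leaf. Its differential at `w₁` is surjective, so `Θ` is open there, and near `w₁`
  -- only points with `ℓ w = σ` land on the sphere itself.
  set Θ : Coord m → Coord m := fun w =>
    c σ + (1 + (ℓ w - σ)) • (Y (w - (ℓ w - σ) • e) - c σ) with hΘ
  set D := fderiv ℝ Y w₁ with hD
  have hproj : HasStrictFDerivAt (fun w : Coord m => w - (ℓ w - σ) • e)
      (ContinuousLinearMap.id ℝ _ - ℓ.smulRight e) w₁ :=
    (hasStrictFDerivAt_id w₁).sub ((ℓ.hasStrictFDerivAt.sub_const σ).smul_const e)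
  have hfix : w₁ - (ℓ w₁ - σ) • e = w₁ := by rw [hℓ₁]; simp
  have hYs : HasStrictFDerivAt Y D (w₁ - (ℓ w₁ - σ) • e) := by
    rw [hfix]
    exact (h.smooth w₁ hσ).fst.hasStrictFDerivAt (by simp)
  have hΘs : HasStrictFDerivAt Θ (D.comp (ContinuousLinearMap.id ℝ _ - ℓ.smulRight e)
      + ℓ.smulRight (Y w₁ - c σ)) w₁ := by
    have h1 := (((ℓ.hasStrictFDerivAt (x := w₁)).sub_const σ).const_add 1).smul
      ((hYs.comp w₁ hproj).sub_const (c σ))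
    have h2 := h1.const_add (c σ)
    refine h2.congr_fderiv ?_
    refine ContinuousLinearMap.ext fun u => ?_
    simp [hℓ₁]
  have hsurj : (D.comp (ContinuousLinearMap.id ℝ _ - ℓ.smulRight e)
      + ℓ.smulRight (Y w₁ - c σ)).range = ⊤ := by
    apply LinearMap.range_eq_top.2
    apply LinearMap.surjective_of_injective
    refine (injective_iff_map_eq_zero _).2 fun u hu => ?_
    have hu' : D (u - ℓ u • e) + ℓ u • (Y w₁ - c σ) = 0 := hu
    have h1 : ℓ (u - ℓ u • e) = 0 := by simp [h.apply_e]
    have h2 := h.inner_fderiv hσ h1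
    have h3 := congrArg (fun y => inner ℝ (Y w₁ - c σ) y) hu'
    simp only [inner_add_right, real_inner_smul_right, inner_zero_right] at h3
    rw [hℓ₁] at h2
    rw [h2, real_inner_self_eq_norm_sq, zero_add] at h3
    have h4 := h.sphere w₁ hσ
    have h5 := h.radius_pos w₁ hσ
    rw [← h4, hℓ₁] at h5
    have h6 : ℓ u = 0 := (mul_eq_zero.1 h3).resolve_right h5.ne'
    rw [h6, zero_smul, zero_smul, sub_zero, add_zero] at hu'
    by_contra hne
    exact h.fderiv_fst_ne_zero hσ h6 hne hu'
  have hmap := hΘs.map_nhds_eq_of_surj hsurj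
  have hΘ₁ : Θ w₁ = Y w₁ := by simp [hΘ, hℓ₁]
  have hev1 : ∀ᶠ w in 𝓝 w₁, w - (ℓ w - σ) • e ∈ O :=
    hproj.continuousAt.eventually_mem (h.isOpen.mem_nhds (by rw [hfix]; exact hσ))
  have hev2 : ∀ᶠ w in 𝓝 w₁, 0 < 1 + (ℓ w - σ) := by
    have : Continuous fun w => 1 + (ℓ w - σ) := by fun_prop
    exact this.continuousAt.eventually_const_lt (by simp [hℓ₁])
  have hΘ₂ : (Ψ w₁).1 = Θ w₁ := hΘ₁.symm
  rw [hΘ₂, ← hmap, Filter.eventually_map]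
  filter_upwards [hp, hev1, hev2] with w hw hwO hpos hx
  have hℓw : ℓ (w - (ℓ w - σ) • e) = σ := by simp [h.apply_e]
  have h1 := h.sphere _ hwO
  have h5 := h.radius_pos _ hwO
  rw [hℓw] at h1 h5
  have h2 : ‖Θ w - c σ‖ ^ 2 = (1 + (ℓ w - σ)) ^ 2 * ρ σ := by
    simp only [hΘ, add_sub_cancel_left, norm_smul, mul_pow, Real.norm_eq_abs, sq_abs]
    rw [← h1]
  rw [h2] at hx
  have h3 : ℓ w = σ := by
    have h6 : (1 + (ℓ w - σ)) ^ 2 = 1 := by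
      apply mul_right_cancel₀ h5.ne'
      rw [hx, one_mul]
    nlinarith
  have h4 : Θ w = (Ψ w).1 := by simp [hΘ, h3, hY]
  rw [h4]
  exact hw h3

theorem exists_local_inverse (h : IsSphereFamily Ψ O ℓ e c ρ) {σ : ℝ} (hσ : σ • e ∈ O)
    (hτ : deriv (slice Ψ e) σ ≠ 0) :
    ∃ η : ℝ → ℝ, ContDiffAt ℝ ∞ η (slice Ψ e σ) ∧ η (slice Ψ e σ) = σ ∧
      ∀ᶠ s in 𝓝 σ, η (slice Ψ e s) = s := by
  have hc := h.contDiffAt_slice hσ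
  have hd : HasFDerivAt (slice Ψ e)
      ((ContinuousLinearEquiv.unitsEquivAut ℝ (Units.mk0 _ hτ) : ℝ ≃L[ℝ] ℝ) : ℝ →L[ℝ] ℝ) σ := by
    refine (hc.differentiableAt (by simp)).hasDerivAt.hasFDerivAt.congr_fderiv ?_
    refine ContinuousLinearMap.ext fun x => ?_
    simp
  refine ⟨hc.localInverse hd (by simp), hc.to_localInverse hd (by simp),
    hc.localInverse_apply_image hd (by simp), ?_⟩
  exact (hc.hasStrictFDerivAt' hd (by simp)).eventually_left_inverse

/-- Where the section rises, the mean curvature equation forces the Euclidean center to move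
vertically, at a speed for which the hyperbolic center does not move. -/
theorem height_smul_deriv_center (hm : 1 ≤ m) (h : IsSphereFamily Ψ O ℓ e c ρ) {H : ℝ}
    (hH : ∀ w ∈ O, HasMeanCurvatureNear Ψ H w) (hHm : H ≠ 0 ∨ m ≠ 1)
    {σ : ℝ} (hσ : σ • e ∈ O) (hτ : deriv (slice Ψ e) σ ≠ 0) :
    height (c σ) • deriv c σ =
      (deriv ρ σ / 2) • EuclideanSpace.single (Fin.last m) (1 : ℝ) := by
  obtain ⟨η, hη, hησ, hηl⟩ := h.exists_local_inverse hσ hτ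
  set w₁ := σ • e with hw₁
  have hℓ₁ : ℓ w₁ = σ := by rw [hw₁, map_smul, h.apply_e, smul_eq_mul, mul_one]
  set t := slice Ψ e σ with ht
  set C := c ∘ η with hC
  set R := ρ ∘ η with hR
  have hCs : ContDiffAt ℝ ∞ C t :=
    ContDiffAt.comp t (by rw [hησ]; exact h.contDiffAt_center hm hσ) hη
  have hRs : ContDiffAt ℝ ∞ R t :=
    ContDiffAt.comp t (by rw [hησ]; exact h.contDiffAt_radius hm hσ) hη
  have h2le : (2 : WithTop ℕ∞) ≤ ∞ := WithTop.coe_le_coe.2 le_top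
  have hC2 := hCs.of_le h2le
  have hR2 := hRs.of_le h2le
  have hCt : C t = c σ := by simp [hC, hησ]
  set k := height (c σ) with hk
  set d := deriv R t / 2 with hd
  -- it suffices to treat the family parametrized by height
  suffices hmain : k • deriv C t = d • EuclideanSpace.single (Fin.last m) (1 : ℝ) by
    have hsl := ((h.contDiffAt_slice hσ).differentiableAt (by simp)).hasDerivAt
    have e1 : deriv c σ = deriv (slice Ψ e) σ • deriv C t := by
      have h1 := ((hCs.differentiableAt (by simp)).hasDerivAt).scomp σ hsl
      refine (h1.congr_of_eventuallyEq ?_).deriv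
      filter_upwards [hηl] with s hs
      simp [hC, hs]
    have e2 : deriv ρ σ = deriv (slice Ψ e) σ * deriv R t := by
      have h1 := ((hRs.differentiableAt (by simp)).hasDerivAt).scomp σ hsl
      refine (h1.congr_of_eventuallyEq ?_).deriv
      filter_upwards [hηl] with s hs
      simp [hR, hs]
    rw [e1, e2, smul_comm, hmain, smul_smul, hd, mul_div_assoc]
  set N := ((m : ℝ) + 1) * H with hN
  set p : Coord m → Prop := fun x => ∀ hh φ φt l : ℝ, hh = height x →
    l = inner ℝ (x - c σ) (deriv C t) → φ = -(l + d) →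
    φt = ‖deriv C t‖ ^ 2 - inner ℝ (x - c σ) (deriv (deriv C) t) - deriv (deriv R) t / 2 →
    N ^ 2 * (hh ^ 2 * ρ σ + φ ^ 2) ^ 3 = hh ^ 2 * (m * ρ σ * k * hh ^ 2
      + (2 * hh + (m - 1) * k) * φ ^ 2 + ρ σ * hh * φt + 2 * hh * φ * l) ^ 2 with hp
  -- After reparametrizing by height, `sphereFun C R` is a defining function of the hypersurface
  -- near `w₁`, so it may replace the one supplied by the mean curvature hypothesis.
  have hsec : ∀ᶠ w in 𝓝 w₁, ℓ w = σ → p (Ψ w).1 := by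
    have hvan : ∀ᶠ w in 𝓝 w₁, sphereFun C R (Ψ w) = 0 := by
      have hη' : ∀ᶠ w in 𝓝 w₁, η (slice Ψ e (ℓ w)) = ℓ w := by
        have : Filter.Tendsto ℓ (𝓝 w₁) (𝓝 σ) := ℓ.continuous.tendsto' _ _ hℓ₁
        exact this.eventually hηl
      filter_upwards [h.eventually_snd hσ, hη'] with w hw hw'
      have := h.sphere w hw.1
      simp only [sphereFun, hC, hR, Function.comp, hw.2.2, hw', this]
      ring
    filter_upwards [hvan.eventually_nhds, h.eventually_snd hσ] with w hw hw' hℓw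
    have hΨw : Ψ w = ((Ψ w).1, t) := Prod.ext rfl (by rw [hw'.2.2, hℓw])
    have hsph := h.sphere w hw'.1
    have hpos := h.radius_pos w hw'.1
    rw [hℓw] at hsph hpos
    have hG : ContDiffAt ℝ 2 (sphereFun C R) (Ψ w) := by
      rw [hΨw]; exact contDiffAt_sphereFun hC2 hR2
    have hdG : fderiv ℝ (sphereFun C R) (Ψ w) ≠ 0 := by
      intro h0
      have h1 := fderiv_sphereFun (x := (Ψ w).1) (hC2.of_le (by norm_num))
        (hR2.of_le (by norm_num)) ((Ψ w).1 - c σ, 0)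
      rw [← hΨw, h0, hCt] at h1
      simp at h1
      linarith
    have key := (hH w hw'.1).mcNum_sq ((h.smooth w hw'.1).of_le h2le) (h.inj w hw'.1)
      (h.height_pos w hw'.1) hG hdG hw
    intro hh φ φt l ehh el eφ eφt
    obtain ⟨k1, k2⟩ := mcNum_sphereFun (x := (Ψ w).1) hC2 hR2 (ρ := ρ σ) (k := k) (φ := φ)
      (φt := φt) (l := l) (by rw [hCt]; exact hsph) ehh.symm (by rw [hCt])
      (by rw [hCt]; exact el) (by rw [eφ]) (by rw [hCt]; exact eφt)
    rw [← ehh] at key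
    rw [← hΨw] at k1 k2
    rw [k1, k2, mul_pow hh] at key
    exact key
  -- From image points of the section to all points of the sphere near `x₀`, and hence to short arcs
  -- of great circles through `x₀`.
  have hsph := h.eventually_exists_section hσ hsec
  have hρ := h.radius_pos _ hσ
  have hkpos := h.center_pos _ hσ
  have hlt := h.radius_lt _ hσ
  have hnorm := h.sphere _ hσ
  rw [hℓ₁] at hρ hkpos hlt hnorm
  set x₀ := (Ψ w₁).1 with hx₀
  set ξ := x₀ - c σ with hξ
  -- Each great circle through `x₀` that is not horizontal gives orthogonality of `V` to the two
  -- vectors `ξ`, `η'` spanning its plane.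
  have hV := eq_zero_of_orthogonal hm (ξ := ξ) (V := k • deriv C t
    - d • EuclideanSpace.single (Fin.last m) (1 : ℝ)) hρ fun η' hη' horth hpos => by
    have harc : Continuous fun z : ℝ => c σ + (Real.cos z • ξ + Real.sin z • η') := by fun_prop
    have h0 : c σ + (Real.cos 0 • ξ + Real.sin 0 • η') = x₀ := by simp [hξ]
    have hz : ∀ᶠ z : ℝ in 𝓝 0, p (c σ + (Real.cos z • ξ + Real.sin z • η')) := by
      have h1 := (harc.tendsto' 0 x₀ h0).eventually hsph
      filter_upwards [h1] with z hz
      apply hz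
      rw [add_sub_cancel_left]
      exact norm_sq_arc hnorm hη' horth z
    have hres := proportional_of_arc_identity (k := k) (ρ := ρ σ) (a := height ξ)
      (b := height η') (α := inner ℝ ξ (deriv C t)) (β := inner ℝ η' (deriv C t)) (d := d)
      (M := m) (H := N) (γ₀ := ‖deriv C t‖ ^ 2 - deriv (deriv R) t / 2)
      (γ₁ := -inner ℝ ξ (deriv (deriv C) t)) (γ₂ := -inner ℝ η' (deriv (deriv C) t))
      hkpos hlt (height_sq_add_height_sq_le hρ hnorm hη' horth) hpos
      (by
        rcases hHm with h1 | h1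
        · left; rw [hN]; positivity
        · right; exact_mod_cast h1) (by
      filter_upwards [hz] with z hz hh φ φt l ehh el eφ eφt
      refine hz hh φ φt l ?_ ?_ eφ ?_
      · rw [ehh]; simp [height, hk]; ring
      · rw [el, add_sub_cancel_left, inner_add_left, real_inner_smul_left, real_inner_smul_left]
        ring
      · rw [eφt, add_sub_cancel_left, inner_add_left, real_inner_smul_left, real_inner_smul_left]
        ring)
    rw [inner_sub_right, inner_sub_right, real_inner_smul_right, real_inner_smul_right,
      real_inner_smul_right, real_inner_smul_right, inner_single_last, inner_single_last]
    exact ⟨sub_eq_zero.2 hres.1, sub_eq_zero.2 hres.2⟩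
  exact sub_eq_zero.1 hV

end IsSphereFamily

/-! ### Unique continuation for minimal pieces tangent to a slice -/

/-- A local solution of a linear differential inequality with a zero vanishes near that zero. -/
theorem eventually_eq_zero_of_abs_deriv_le {f f' : ℝ → ℝ} {K a : ℝ} (ha : f a = 0)
    (h : ∀ᶠ s in 𝓝 a, HasDerivAt f (f' s) s ∧ |f' s| ≤ K * |f s|) :
    ∀ᶠ s in 𝓝 a, f s = 0 := by
  obtain ⟨δ, hδ, hball⟩ := Metric.eventually_nhds_iff.1 h
  have hright : ∀ (g g' : ℝ → ℝ), g 0 = 0 →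
      (∀ x, |x| < δ → HasDerivAt g (g' x) x ∧ |g' x| ≤ K * |g x|) →
      ∀ x, 0 ≤ x → x < δ → g x = 0 := by
    intro g g' hg0 hg x hx0 hxδ
    refine eq_zero_of_abs_deriv_le_mul_abs_self_of_eq_zero_right (f := g) (f' := g') (K := K)
      (a := 0) (b := x) ?_ ?_ hg0 ?_ x ⟨hx0, le_rfl⟩
    · intro y hy
      exact (hg y (by rw [abs_of_nonneg hy.1]; linarith [hy.2])).1.continuousAt.continuousWithinAt
    · intro y hy
      exact (hg y (by rw [abs_of_nonneg hy.1]; linarith [hy.2])).1.hasDerivWithinAt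
    · intro y hy
      exact (hg y (by rw [abs_of_nonneg hy.1]; linarith [hy.2])).2
  have h1 := hright (fun x => f (a + x)) (fun x => f' (a + x)) (by simpa using ha) (fun x hx => by
    have := hball (y := a + x) (by simpa [Real.dist_eq] using hx)
    exact ⟨this.1.comp_const_add a x, this.2⟩)
  have h2 := hright (fun x => f (a - x)) (fun x => -f' (a - x)) (by simpa using ha) (fun x hx => by
    have := hball (y := a - x) (by simpa [Real.dist_eq] using hx)
    exact ⟨this.1.comp_const_sub a x, by rw [abs_neg]; exact this.2⟩)
  filter_upwards [Metric.ball_mem_nhds a hδ] with s hs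
  rw [Metric.mem_ball, Real.dist_eq, abs_lt] at hs
  rcases le_total a s with has | has
  · have := h1 (s - a) (by linarith) (by linarith)
    simpa using this
  · have := h2 (a - s) (by linarith) (by linarith)
    simpa using this

/-- A function whose zero set is the graph of `τ ∘ s` over `ℝⁿ`. -/
def graphFun {m : ℕ} (τ : ℝ → ℝ) (s : Coord m → ℝ) (y : Coord m × ℝ) : ℝ := y.2 - τ (s y.1)

theorem contDiffAt_graphFun {m : ℕ} {τ : ℝ → ℝ} {s : Coord m → ℝ} {x : Coord m} {t : ℝ}
    {k : WithTop ℕ∞} (hτ : ContDiffAt ℝ k τ (s x)) (hs : ContDiffAt ℝ k s x) :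
    ContDiffAt ℝ k (graphFun τ s) (x, t) := by
  have h1 : ContDiffAt ℝ k (fun y : Coord m × ℝ => s y.1) (x, t) :=
    ContDiffAt.comp (g := s) (x, t) hs contDiffAt_fst
  exact contDiffAt_snd.sub (ContDiffAt.comp (g := τ) (x, t) hτ h1)

theorem fderiv_graphFun {m : ℕ} {τ : ℝ → ℝ} {s : Coord m → ℝ} {x : Coord m} {t : ℝ}
    (hτ : ContDiffAt ℝ 1 τ (s x)) (hs : ContDiffAt ℝ 1 s x) (v : Coord m × ℝ) :
    fderiv ℝ (graphFun τ s) (x, t) v = v.2 - deriv τ (s x) * fderiv ℝ s x v.1 := by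
  have h1 : HasFDerivAt (fun y : Coord m × ℝ => s y.1)
      ((fderiv ℝ s x).comp (ContinuousLinearMap.fst ℝ _ _)) (x, t) :=
    HasFDerivAt.comp (g := s) (x, t) (hs.differentiableAt (by norm_num)).hasFDerivAt hasFDerivAt_fst
  have h2 := HasDerivAt.comp_hasFDerivAt (h₂ := τ) (x, t)
    (hτ.differentiableAt (by norm_num)).hasDerivAt h1
  have h3 : HasFDerivAt (graphFun τ s) (ContinuousLinearMap.snd ℝ _ _ -
      deriv τ (s x) • (fderiv ℝ s x).comp (ContinuousLinearMap.fst ℝ _ _)) (x, t) :=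
    hasFDerivAt_snd.sub h2
  rw [h3.fderiv]
  simp

theorem second_fderiv_graphFun {m : ℕ} {τ : ℝ → ℝ} {s : Coord m → ℝ} {x : Coord m} {t : ℝ}
    (hτ : ContDiffAt ℝ 2 τ (s x)) (hs : ContDiffAt ℝ 2 s x) (v : Coord m × ℝ) :
    fderiv ℝ (fderiv ℝ (graphFun τ s)) (x, t) v v =
      -(deriv (deriv τ) (s x) * (fderiv ℝ s x v.1) ^ 2
        + deriv τ (s x) * fderiv ℝ (fderiv ℝ s) x v.1 v.1) := by
  have hD : DifferentiableAt ℝ (fderiv ℝ (graphFun τ s)) (x, t) :=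
    ((contDiffAt_graphFun (t := t) hτ hs).fderiv_right (m := 1) (by norm_num)).differentiableAt
      (by norm_num)
  have h1 := hD.hasFDerivAt.clm_apply (hasFDerivAt_const v (x, t))
  have hs1 : HasFDerivAt s (fderiv ℝ s x) x := (hs.differentiableAt (by norm_num)).hasFDerivAt
  have hdτ : HasDerivAt (deriv τ) (deriv (deriv τ) (s x)) (s x) :=
    ((contDiffAt_deriv (k := 1) hτ (by norm_num)).differentiableAt (by norm_num)).hasDerivAt
  have hds : HasFDerivAt (fderiv ℝ s) (fderiv ℝ (fderiv ℝ s) x) x :=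
    ((hs.fderiv_right (m := 1) (by norm_num)).differentiableAt (by norm_num)).hasFDerivAt
  have h2 : HasFDerivAt (fun y => deriv τ (s y)) (deriv (deriv τ) (s x) • fderiv ℝ s x) x :=
    hdτ.comp_hasFDerivAt x hs1
  have h3 := (h2.fun_mul (hds.clm_apply (hasFDerivAt_const v.1 x))).const_sub v.2
  have h4 := HasFDerivAt.comp (f := (Prod.fst : Coord m × ℝ → Coord m))
    (g := fun y => v.2 - deriv τ (s y) * fderiv ℝ s y v.1) (x, t) h3 hasFDerivAt_fst
  have hev : (fun y => fderiv ℝ (graphFun τ s) y v) =ᶠ[𝓝 (x, t)]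
      (fun y => v.2 - deriv τ (s y) * fderiv ℝ s y v.1) ∘ Prod.fst := by
    have hfst : Filter.Tendsto (Prod.fst : Coord m × ℝ → Coord m) (𝓝 (x, t)) (𝓝 x) :=
      continuous_fst.tendsto _
    have e1 : ∀ᶠ y : Coord m × ℝ in 𝓝 (x, t), ContDiffAt ℝ 2 τ (s y.1) :=
      (hs.continuousAt.tendsto.comp hfst).eventually (hτ.eventually (by simp))
    have e2 : ∀ᶠ y : Coord m × ℝ in 𝓝 (x, t), ContDiffAt ℝ 2 s y.1 :=
      hfst.eventually (hs.eventually (by simp))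
    filter_upwards [e1, e2] with y e1 e2
    exact fderiv_graphFun (e1.of_le (by norm_num)) (e2.of_le (by norm_num)) v
  have h5 := DFunLike.congr_fun (h1.unique (h4.congr_of_eventuallyEq hev)) v
  simp at h5
  rw [h5]
  ring

/-- If the graph of `τ ∘ s` is minimal at a point, then `τ''` is controlled by `τ'` there. -/
theorem second_deriv_of_mcNum_eq_zero {m : ℕ} {τ : ℝ → ℝ} {s : Coord m → ℝ} {x : Coord m}
    {t h g a : ℝ} {ζ : Coord m}
    (hτ : ContDiffAt ℝ 2 τ (s x)) (hs : ContDiffAt ℝ 2 s x)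
    (hg : g = ∑ i, fderiv ℝ s x (EuclideanSpace.single i 1) ^ 2)
    (ha : a = deriv τ (s x))
    (hζ : ζ = ∑ i, (h ^ 2 * fderiv ℝ s x (EuclideanSpace.single i 1)) • EuclideanSpace.single i 1)
    (h0 : mcNum h (fderiv ℝ (graphFun τ s) (x, t)) (fderiv ℝ (fderiv ℝ (graphFun τ s)) (x, t)) = 0) :
    deriv (deriv τ) (s x) * (h ^ 2 * g) = a * (a ^ 2 * fderiv ℝ (fderiv ℝ s) x ζ ζ
      + h ^ 3 * a ^ 2 * fderiv ℝ s x (EuclideanSpace.single (Fin.last m) 1) * g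
      - (1 + a ^ 2 * h ^ 2 * g) * (h ^ 2 * ∑ i, fderiv ℝ (fderiv ℝ s) x
          (EuclideanSpace.single i 1) (EuclideanSpace.single i 1)
        + (1 - m) * h * fderiv ℝ s x (EuclideanSpace.single (Fin.last m) 1))) := by
  have hA := fderiv_graphFun (t := t) (hτ.of_le (by norm_num)) (hs.of_le (by norm_num))
  have hB := second_fderiv_graphFun (t := t) hτ hs
  set A := fderiv ℝ (graphFun τ s) (x, t)
  set B := fderiv ℝ (fderiv ℝ (graphFun τ s)) (x, t)
  have hAi : ∀ i, A (bx i) = -(a * fderiv ℝ s x (EuclideanSpace.single i 1)) := fun i => by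
    rw [hA, ha]; simp [bx]
  have hAt : A bt = 1 := by rw [hA]; simp [bt]
  have hsum : ∑ i, A (bx i) ^ 2 = a ^ 2 * g := by
    rw [hg, Finset.mul_sum]
    exact Finset.sum_congr rfl fun i _ => by rw [hAi]; ring
  have hN : normSqOf h A = 1 + a ^ 2 * h ^ 2 * g := by
    rw [normSqOf, hsum, hAt]; ring
  have hBi : ∑ i, B (bx i) (bx i) = -(deriv (deriv τ) (s x) * g + a * ∑ i,
      fderiv ℝ (fderiv ℝ s) x (EuclideanSpace.single i 1) (EuclideanSpace.single i 1)) := by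
    rw [hg, Finset.mul_sum, Finset.mul_sum, ← Finset.sum_add_distrib, ← Finset.sum_neg_distrib]
    exact Finset.sum_congr rfl fun i _ => by rw [hB, ha]; rfl
  have hBt : B bt bt = 0 := by rw [hB]; simp [bt]
  have hZ : (gradOf h A).1 = -a • ζ := by
    rw [hζ]
    ext j
    simp [gradOf, hAi, Finset.sum_apply, Pi.single_apply]
    ring
  have hsζ : fderiv ℝ s x ζ = h ^ 2 * g := by
    rw [hζ, hg, map_sum, Finset.mul_sum]
    exact Finset.sum_congr rfl fun i _ => by rw [map_smul, smul_eq_mul]; ring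
  have hBZ : B (gradOf h A) (gradOf h A) = -(deriv (deriv τ) (s x) * (a * (h ^ 2 * g)) ^ 2
      + a * (a ^ 2 * fderiv ℝ (fderiv ℝ s) x ζ ζ)) := by
    rw [hB, hZ, ← ha]
    simp only [map_smul, smul_apply, smul_eq_mul, hsζ]
    ring
  rw [mcNum, mcSecond, hN, hBZ, hsum, hBt, hBi, hAi] at h0
  linear_combination -h0

namespace IsSphereFamily

variable {m : ℕ} {Ψ : Coord m → Coord m × ℝ} {O : Set (Coord m)} {ℓ : Coord m →L[ℝ] ℝ}
  {e : Coord m} {c : ℝ → Coord m} {ρ : ℝ → ℝ}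

/-- A horizontal piece has mean curvature zero. -/
theorem eq_zero_of_horizontal (h : IsSphereFamily Ψ O ℓ e c ρ) {H : ℝ} {w : Coord m} (hw : w ∈ O)
    (hH : HasMeanCurvatureNear Ψ H w) (hconst : ∀ᶠ v in 𝓝 w, (Ψ v).2 = (Ψ w).2) : H = 0 := by
  have h2le : (2 : WithTop ℕ∞) ≤ ∞ := WithTop.coe_le_coe.2 le_top
  set G : Coord m × ℝ → ℝ := fun y => y.2 - (Ψ w).2 with hG
  have hdG : ∀ y, fderiv ℝ G y = ContinuousLinearMap.snd ℝ (Coord m) ℝ := fun y =>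
    (hasFDerivAt_snd.sub_const _).fderiv
  have hdG' : fderiv ℝ G = fun _ => ContinuousLinearMap.snd ℝ (Coord m) ℝ := funext hdG
  have h0 : fderiv ℝ (fderiv ℝ G) (Ψ w) = 0 := by
    rw [hdG']; exact (hasFDerivAt_const _ _).fderiv
  have key := hH.mcNum_sq ((h.smooth w hw).of_le h2le) (h.inj w hw) (h.height_pos w hw)
    (G := G) (contDiffAt_snd.sub contDiffAt_const) (by
      rw [hdG]; intro hcon
      have := DFunLike.congr_fun hcon (bt : Coord m × ℝ)
      simp [bt] at this) (hconst.mono fun v hv => by simp [hG, hv])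
  rw [h0, hdG] at key
  simp [normSqOf, mcNum, mcSecond, bx, bt] at key
  exact key.resolve_left (by positivity)

theorem fderiv_snd (h : IsSphereFamily Ψ O ℓ e c ρ) {σ : ℝ} (hσ : σ • e ∈ O) (v : Coord m) :
    (fderiv ℝ Ψ (σ • e) v).2 = deriv (slice Ψ e) σ * ℓ v := by
  have hℓ₁ : ℓ (σ • e) = σ := by rw [map_smul, h.apply_e, smul_eq_mul, mul_one]
  have h1 : HasFDerivAt (fun w => (Ψ w).2)
      ((ContinuousLinearMap.snd ℝ _ _).comp (fderiv ℝ Ψ (σ • e))) (σ • e) := (h.hasFDerivAt hσ).snd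
  have hs : HasDerivAt (slice Ψ e) (deriv (slice Ψ e) σ) (ℓ (σ • e)) := by
    rw [hℓ₁]; exact ((h.contDiffAt_slice hσ).differentiableAt (by simp)).hasDerivAt
  have h2 := (hs.comp_hasFDerivAt (σ • e) ℓ.hasFDerivAt).congr_of_eventuallyEq
    ((h.eventually_snd hσ).mono fun w hw => hw.2.2)
  exact DFunLike.congr_fun (h1.unique h2) v

/-- Unique continuation: a minimal sphere family that is tangent to a horizontal slice along a
section is horizontal near that section. -/
theorem eventually_deriv_slice_eq_zero (h : IsSphereFamily Ψ O ℓ e c ρ)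
    (hH : ∀ w ∈ O, HasMeanCurvatureNear Ψ 0 w) {σ : ℝ} (hσ : σ • e ∈ O)
    (hτ : deriv (slice Ψ e) σ = 0) : ∀ᶠ s in 𝓝 σ, deriv (slice Ψ e) s = 0 := by
  have h2le : (2 : WithTop ℕ∞) ≤ ∞ := WithTop.coe_le_coe.2 le_top
  set w₁ := σ • e with hw₁
  have hℓe : ∀ s : ℝ, ℓ (s • e) = s := fun s => by
    rw [map_smul, h.apply_e, smul_eq_mul, mul_one]
  set Y : Coord m → Coord m := fun z => (Ψ z).1 with hY
  set τ := slice Ψ e with hτdef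
  have hYs : ContDiffAt ℝ ∞ Y w₁ := (h.smooth w₁ hσ).fst
  -- At the tangency the differential of the vertical component vanishes, so immersivity passes to
  -- the projection `Y`. The hypersurface is locally a graph, and its height is `τ ∘ s`, with `s`
  -- the leaf parameter read on the base.
  have hinj : Function.Injective (fderiv ℝ Y w₁) := by
    refine (injective_iff_map_eq_zero _).2 fun v hv => ?_
    apply h.inj w₁ hσ
    rw [map_zero]
    refine Prod.ext ?_ ?_
    · rw [← h.fderiv_fst hσ]; exact hv
    · rw [h.fderiv_snd hσ, hτ, zero_mul]; rfl
  set T : Coord m ≃L[ℝ] Coord m := (LinearEquiv.ofInjectiveEndo (fderiv ℝ Y w₁).toLinearMap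
      hinj).toContinuousLinearEquiv with hT
  have hYd : HasFDerivAt Y (T : Coord m →L[ℝ] Coord m) w₁ := h.hasFDerivAt_fst hσ
  set s : Coord m → ℝ := fun x => ℓ (hYs.localInverse hYd (by simp) x) with hs
  have hsY : ∀ᶠ w in 𝓝 w₁, s (Y w) = ℓ w := by
    filter_upwards [(hYs.hasStrictFDerivAt' hYd (by simp)).eventually_left_inverse] with w hw
    exact congrArg ℓ hw
  have hss : ContDiffAt ℝ ∞ s (Y w₁) :=
    ℓ.contDiff.contDiffAt.comp _ (hYs.to_localInverse hYd (by simp))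
  have hline : Continuous fun r : ℝ => r • e := by fun_prop
  have htend : Filter.Tendsto (fun r : ℝ => r • e) (𝓝 σ) (𝓝 w₁) := hline.tendsto σ
  have hYcont : ContinuousAt (fun r : ℝ => Y (r • e)) σ :=
    ContinuousAt.comp (g := Y) hYs.continuousAt hline.continuousAt
  have hhcont : ContinuousAt (fun r : ℝ => height (Y (r • e))) σ := by
    have : Continuous (height : Coord m → ℝ) := by unfold height; fun_prop
    exact this.continuousAt.comp hYcont
  have hτc : ContDiffAt ℝ ∞ τ σ := h.contDiffAt_slice hσ
  have hdτ : ContinuousAt (deriv τ) σ :=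
    (contDiffAt_deriv (k := ∞) hτc (by simp)).continuousAt
  have hds : ContinuousAt (fun r : ℝ => fderiv ℝ s (Y (r • e))) σ :=
    ContinuousAt.comp (g := fderiv ℝ s)
      (hss.fderiv_right (m := ∞) (by simp)).continuousAt hYcont
  have hdds : ContinuousAt (fun r : ℝ => fderiv ℝ (fderiv ℝ s) (Y (r • e))) σ :=
    ContinuousAt.comp (g := fderiv ℝ (fderiv ℝ s))
      ((hss.fderiv_right (m := ∞) (by simp)).fderiv_right (m := ∞) (by simp)).continuousAt hYcont
  have hdsv : ∀ v, ContinuousAt (fun r : ℝ => fderiv ℝ s (Y (r • e)) v) σ := fun v =>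
    hds.clm_apply continuousAt_const
  set g : ℝ → ℝ := fun r => ∑ i, fderiv ℝ s (Y (r • e)) (EuclideanSpace.single i 1) ^ 2 with hg
  have hgc : ContinuousAt g σ := tendsto_finsetSum _ fun i _ => (hdsv _).pow 2
  set ζ : ℝ → Coord m := fun r => ∑ i, (height (Y (r • e)) ^ 2 *
    fderiv ℝ s (Y (r • e)) (EuclideanSpace.single i 1)) • EuclideanSpace.single i 1 with hζ
  have hζc : ContinuousAt ζ σ :=
    tendsto_finsetSum _ fun i _ => ((hhcont.pow 2).mul (hdsv _)).smul continuousAt_const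
  set b : ℝ → ℝ := fun r => deriv τ r ^ 2 * fderiv ℝ (fderiv ℝ s) (Y (r • e)) (ζ r) (ζ r)
      + height (Y (r • e)) ^ 3 * deriv τ r ^ 2
        * fderiv ℝ s (Y (r • e)) (EuclideanSpace.single (Fin.last m) 1) * g r
      - (1 + deriv τ r ^ 2 * height (Y (r • e)) ^ 2 * g r) * (height (Y (r • e)) ^ 2 *
        ∑ i, fderiv ℝ (fderiv ℝ s) (Y (r • e))
          (EuclideanSpace.single i 1) (EuclideanSpace.single i 1)
        + (1 - m) * height (Y (r • e))
          * fderiv ℝ s (Y (r • e)) (EuclideanSpace.single (Fin.last m) 1)) with hb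
  have hbc : ContinuousAt b σ := by
    have hsum : ContinuousAt (fun r : ℝ => ∑ i, fderiv ℝ (fderiv ℝ s) (Y (r • e))
          (EuclideanSpace.single i 1) (EuclideanSpace.single i 1)) σ :=
      tendsto_finsetSum _ fun i _ =>
        (hdds.clm_apply continuousAt_const).clm_apply continuousAt_const
    refine ContinuousAt.sub (ContinuousAt.add ?_ ?_) (ContinuousAt.mul ?_ (ContinuousAt.add ?_ ?_))
    · exact (hdτ.pow 2).mul ((hdds.clm_apply hζc).clm_apply hζc)
    · exact (((hhcont.pow 3).mul (hdτ.pow 2)).mul (hdsv _)).mul hgc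
    · exact continuousAt_const.add (((hdτ.pow 2).mul (hhcont.pow 2)).mul hgc)
    · exact (hhcont.pow 2).mul hsum
    · exact (continuousAt_const.mul hhcont).mul (hdsv _)
  -- the function `s` is a submersion
  have hg0 : g σ ≠ 0 := by
    intro h0
    have h1 : ∀ i, fderiv ℝ s (Y w₁) (EuclideanSpace.single i 1) = 0 := fun i => by
      have := (Finset.sum_eq_zero_iff_of_nonneg fun i _ => sq_nonneg _).1 h0 i (Finset.mem_univ i)
      simpa using this
    have h2 : fderiv ℝ s (Y w₁) = 0 := by
      refine ContinuousLinearMap.ext fun v => ?_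
      have hv : v = ∑ i, v i • EuclideanSpace.single i (1 : ℝ) := by
        ext j; simp [Finset.sum_apply, Pi.single_apply]
      rw [hv, map_sum]
      simp [h1]
    have h3 : HasFDerivAt (fun w => s (Y w)) ((fderiv ℝ s (Y w₁)).comp (fderiv ℝ Y w₁)) w₁ :=
      HasFDerivAt.comp (g := s) w₁ (hss.differentiableAt (by simp)).hasFDerivAt
        (h.hasFDerivAt_fst hσ)
    have h4 := DFunLike.congr_fun
      (h3.unique (ℓ.hasFDerivAt.congr_of_eventuallyEq hsY)) e
    rw [h2, h.apply_e] at h4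
    simp at h4
  have hheight : height (Y w₁) ≠ 0 := (h.height_pos w₁ hσ).ne'
  set q : ℝ → ℝ := fun r => b r / (height (Y (r • e)) ^ 2 * g r) with hq
  have hqc : ContinuousAt q σ :=
    hbc.div ((hhcont.pow 2).mul hgc) (mul_ne_zero (pow_ne_zero 2 hheight) hg0)
  have hqb : ∀ᶠ r in 𝓝 σ, |q r| < |q σ| + 1 :=
    hqc.abs.eventually_lt_const (by linarith)
  -- Along the transversal `r ↦ r • e`, minimality of the graph reads `τ'' = q τ'`, where `q` is
  -- continuous at `σ` and hence bounded nearby.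
  refine eventually_eq_zero_of_abs_deriv_le (f' := deriv (deriv τ)) (K := |q σ| + 1) hτ ?_
  have hvan : ∀ᶠ w in 𝓝 w₁, graphFun τ s (Ψ w) = 0 := by
    filter_upwards [h.eventually_snd hσ, hsY] with w hw hw'
    have : s (Ψ w).1 = ℓ w := hw'
    simp only [graphFun, hw.2.2, this]
    exact sub_self _
  have e1 : ∀ᶠ r in 𝓝 σ, ContDiffAt ℝ 2 τ r := (hτc.of_le h2le).eventually (by simp)
  have e2 : ∀ᶠ r : ℝ in 𝓝 σ, ContDiffAt ℝ 2 s (Y (r • e)) :=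
    hYcont.eventually ((hss.of_le h2le).eventually (by simp))
  have e3 : ∀ᶠ r : ℝ in 𝓝 σ, s (Y (r • e)) = r := by
    filter_upwards [htend.eventually hsY] with r hr
    rw [hr, hℓe]
  have e4 := htend.eventually hvan.eventually_nhds
  have e5 := hgc.eventually_ne hg0
  filter_upwards [hqb, e1, e2, e3, e4, e5, h.eventually_mem hσ] with r hqr e1 e2 e3 e4 e5 hr
  refine ⟨((contDiffAt_deriv (k := 1) e1 (by norm_num)).differentiableAt
    (by norm_num)).hasDerivAt, ?_⟩
  have e1' : ContDiffAt ℝ 2 τ (s (Y (r • e))) := by rw [e3]; exact e1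
  have hP : Ψ (r • e) = (Y (r • e), (Ψ (r • e)).2) := rfl
  have hmc : mcNum (height (Y (r • e))) (fderiv ℝ (graphFun τ s) (Ψ (r • e)))
      (fderiv ℝ (fderiv ℝ (graphFun τ s)) (Ψ (r • e))) = 0 := by
    have key := (hH _ hr).mcNum_sq ((h.smooth _ hr).of_le h2le) (h.inj _ hr) (h.height_pos _ hr)
      (G := graphFun τ s) (by rw [hP]; exact contDiffAt_graphFun e1' e2) (by
        intro h0
        have := fderiv_graphFun (t := (Ψ (r • e)).2) (e1'.of_le (by norm_num))
          (e2.of_le (by norm_num)) bt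
        rw [← hP, h0] at this
        simp [bt] at this) e4
    rw [mul_zero, zero_pow two_ne_zero, zero_mul] at key
    exact pow_eq_zero_iff two_ne_zero |>.1 key.symm
  rw [hP] at hmc
  have hode := second_deriv_of_mcNum_eq_zero (g := g r) (a := deriv τ r) (ζ := ζ r) e1' e2 rfl
    (by rw [e3]) rfl hmc
  rw [e3] at hode
  have hpos : height (Y (r • e)) ^ 2 * g r ≠ 0 :=
    mul_ne_zero (pow_ne_zero 2 (h.height_pos _ hr).ne') e5
  have hode' : deriv (deriv τ) r = q r * deriv τ r := by
    rw [eq_div_of_mul_eq hpos hode, hq, mul_comm (deriv τ r), div_mul_eq_mul_div]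
  rw [hode', abs_mul]
  exact mul_le_mul_of_nonneg_right hqr.le (abs_nonneg _)

end IsSphereFamily

/-! ### Euclidean and hyperbolic centers -/

/-- The Euclidean center of the geodesic sphere with hyperbolic center `a` and radius `R`. -/
def euclCenter {m : ℕ} (a : Coord m) (R : ℝ) : Coord m :=
  a + (height a * (Real.cosh R - 1)) • EuclideanSpace.single (Fin.last m) (1 : ℝ)

theorem height_euclCenter {m : ℕ} (a : Coord m) (R : ℝ) :
    height (euclCenter a R) = height a * Real.cosh R := by
  simp [euclCenter, height]; ring

theorem euclCenter_apply {m : ℕ} (a : Coord m) (R : ℝ) {i : Fin (m + 1)} (hi : i ≠ Fin.last m) :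
    euclCenter a R i = a i := by
  simp [euclCenter, hi]

/-- A geodesic sphere of the half-space model is a Euclidean sphere. -/
theorem norm_sub_euclCenter_sq {m : ℕ} {a x : Coord m} {R : ℝ} (ha : a ∈ halfSpace m)
    (hx : x ∈ hsphere a R) : ‖x - euclCenter a R‖ ^ 2 = (height a * Real.sinh R) ^ 2 := by
  obtain ⟨hxh, hd⟩ := hx
  have ha' : 0 < height a := ha
  have hx' : 0 < height x := hxh
  have h1 : Real.arsinh (dist x a / (2 * √(height x * height a))) = R / 2 := by
    rw [hdist] at hd; linarith
  have h2 : dist x a / (2 * √(height x * height a)) = Real.sinh (R / 2) := by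
    rw [← h1, Real.sinh_arsinh]
  have hs : 0 < √(height x * height a) := Real.sqrt_pos.2 (by positivity)
  have h3 : dist x a = Real.sinh (R / 2) * (2 * √(height x * height a)) := by
    rw [← h2]; field_simp
  have h4 : Real.cosh R - 1 = 2 * Real.sinh (R / 2) ^ 2 := by
    have := Real.cosh_two_mul (R / 2)
    rw [Real.cosh_sq, mul_div_cancel₀ R two_ne_zero] at this
    linarith
  have h5 : ‖x - a‖ ^ 2 = 2 * height x * height a * (Real.cosh R - 1) := by
    rw [← dist_eq_norm, h3, mul_pow, mul_pow, Real.sq_sqrt (by positivity), h4]; ring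
  have h6 : x - euclCenter a R = (x - a)
      - (height a * (Real.cosh R - 1)) • EuclideanSpace.single (Fin.last m) (1 : ℝ) := by
    rw [euclCenter]; abel
  have h7 : height (x - a) = height x - height a := rfl
  rw [h6, norm_sub_sq_real, h5, real_inner_smul_right, inner_single_last, norm_smul, h7, mul_pow,
    mul_pow, Real.sinh_sq]
  simp only [Real.norm_eq_abs, sq_abs, PiLp.norm_single, norm_one]
  ring

/-- Since `cosh² - sinh² = 1`, the squared height of the Euclidean center minus the squared
Euclidean radius is the squared height of the hyperbolic center; the other coordinates of the two
centers agree. -/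
theorem eq_of_center_invariants {m : ℕ} {a a' : Coord m} {R R' : ℝ} (ha : a ∈ halfSpace m)
    (ha' : a' ∈ halfSpace m)
    (h1 : ∀ i, i ≠ Fin.last m → euclCenter a R i = euclCenter a' R' i)
    (h2 : height (euclCenter a R) ^ 2 - (height a * Real.sinh R) ^ 2
      = height (euclCenter a' R') ^ 2 - (height a' * Real.sinh R') ^ 2) : a = a' := by
  ext i
  by_cases hi : i = Fin.last m
  · subst hi
    rw [height_euclCenter, height_euclCenter, mul_pow, mul_pow, mul_pow, mul_pow, Real.sinh_sq,
      Real.sinh_sq] at h2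
    have h3 : height a ^ 2 = height a' ^ 2 := by linarith
    exact (pow_left_inj₀ (le_of_lt ha) (le_of_lt ha') two_ne_zero).1 h3
  · have := h1 i hi
    rwa [euclCenter_apply a R hi, euclCenter_apply a' R' hi] at this

/-! ### Constancy of the hyperbolic center in a coordinate ball -/

namespace IsSphereFamily

variable {m : ℕ} {Ψ : Coord m → Coord m × ℝ} {O : Set (Coord m)} {ℓ : Coord m →L[ℝ] ℝ}
  {e : Coord m} {c : ℝ → Coord m} {ρ : ℝ → ℝ}

theorem eventually_snd_eq (h : IsSphereFamily Ψ O ℓ e c ρ) {σ : ℝ} (hσ : σ • e ∈ O)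
    (hτ : ∀ᶠ s in 𝓝 σ, deriv (slice Ψ e) s = 0) :
    ∀ᶠ v in 𝓝 (σ • e), (Ψ v).2 = (Ψ (σ • e)).2 := by
  have hℓ₁ : ℓ (σ • e) = σ := by rw [map_smul, h.apply_e, smul_eq_mul, mul_one]
  obtain ⟨δ, hδ, hball⟩ := Metric.eventually_nhds_iff_ball.1 (hτ.and (h.eventually_mem hσ))
  have hconst : ∀ s ∈ Metric.ball σ δ, slice Ψ e s = slice Ψ e σ := fun s hs =>
    Metric.isOpen_ball.is_const_of_deriv_eq_zero (convex_ball σ δ).isPreconnected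
      (fun r hr => ((h.contDiffAt_slice (hball r hr).2).differentiableAt
        (by simp)).differentiableWithinAt)
      (fun r hr => (hball r hr).1) hs (Metric.mem_ball_self hδ)
  have htend : Filter.Tendsto ℓ (𝓝 (σ • e)) (𝓝 σ) := ℓ.continuous.tendsto' _ _ hℓ₁
  filter_upwards [h.eventually_snd hσ, htend.eventually (Metric.ball_mem_nhds σ hδ)] with v hv hv'
  rw [hv.2.2, hconst _ hv']
  rfl

theorem deriv_slice_eq_zero_of_horizontal (h : IsSphereFamily Ψ O ℓ e c ρ) {w : Coord m}
    (hw : w ∈ O) (hw' : ℓ w • e ∈ O) (hconst : ∀ᶠ v in 𝓝 w, (Ψ v).2 = (Ψ w).2) :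
    deriv (slice Ψ e) (ℓ w) = 0 := by
  have hcont : Continuous fun s : ℝ => w + (s - ℓ w) • e := by fun_prop
  have htend : Filter.Tendsto (fun s : ℝ => w + (s - ℓ w) • e) (𝓝 (ℓ w)) (𝓝 w) :=
    hcont.tendsto' _ _ (by simp)
  refine ((hasDerivAt_const (ℓ w) (Ψ w).2).congr_of_eventuallyEq ?_).deriv
  filter_upwards [htend.eventually hconst, htend.eventually (h.isOpen.mem_nhds hw),
    h.eventually_mem hw'] with s h1 h2 h3
  rw [← h1]
  exact h.level _ h3 _ h2 (by simp [h.apply_e])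

/-- Both sides are continuous in the parameter. If they differed at `σ` they would differ nearby,
which forces the leaf height to be stationary on an interval and yields a horizontal piece. -/
theorem height_smul_deriv_center_of_nowhere_horizontal (hm : 1 ≤ m)
    (h : IsSphereFamily Ψ O ℓ e c ρ) {H : ℝ}
    (hH : ∀ w ∈ O, HasMeanCurvatureNear Ψ H w) (hHm : H ≠ 0 ∨ m ≠ 1)
    (hnh : ∀ w ∈ O, ¬ ∀ᶠ v in 𝓝 w, (Ψ v).2 = (Ψ w).2) {σ : ℝ} (hσ : σ • e ∈ O) :
    height (c σ) • deriv c σ =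
      (deriv ρ σ / 2) • EuclideanSpace.single (Fin.last m) (1 : ℝ) := by
  by_contra hne
  have hc := h.contDiffAt_center hm hσ
  have hρ := h.contDiffAt_radius hm hσ
  have hheight : Continuous (height : Coord m → ℝ) := by unfold height; fun_prop
  have h1 : ContinuousAt (fun s => height (c s) • deriv c s) σ :=
    (hheight.continuousAt.comp hc.continuousAt).smul
      (contDiffAt_deriv (k := ∞) hc (by simp)).continuousAt
  have h2 : ContinuousAt (fun s => (deriv ρ s / 2) •
      (EuclideanSpace.single (Fin.last m) (1 : ℝ) : Coord m)) σ :=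
    ((contDiffAt_deriv (k := ∞) hρ (by simp)).continuousAt.div_const 2).smul continuousAt_const
  refine hnh _ hσ (h.eventually_snd_eq hσ ?_)
  filter_upwards [(h1.sub h2).eventually_ne (sub_ne_zero.2 hne), h.eventually_mem hσ] with s hs hs'
  by_contra hτ
  exact hs (sub_eq_zero.2 (h.height_smul_deriv_center hm hH hHm hs' hτ))

/-- In a nowhere horizontal sphere family of constant mean curvature, the quantities that
determine the hyperbolic center are constant. -/
theorem center_invariants (hm : 1 ≤ m) {ε : ℝ}
    (h : IsSphereFamily Ψ (Metric.ball 0 ε) ℓ e c ρ) {H : ℝ}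
    (hH : ∀ w ∈ Metric.ball 0 ε, HasMeanCurvatureNear Ψ H w) (hHm : H ≠ 0 ∨ m ≠ 1)
    (hnh : ∀ w ∈ Metric.ball 0 ε, ¬ ∀ᶠ v in 𝓝 w, (Ψ v).2 = (Ψ w).2) {σ : ℝ}
    (hσ : σ • e ∈ Metric.ball 0 ε) :
    (∀ i, i ≠ Fin.last m → c σ i = c 0 i) ∧
      height (c σ) ^ 2 - ρ σ = height (c 0) ^ 2 - ρ 0 := by
  set I : Set ℝ := (fun s : ℝ => s • e) ⁻¹' Metric.ball 0 ε with hI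
  have hIo : IsOpen I := Metric.isOpen_ball.preimage (by fun_prop)
  have hIc : IsPreconnected I := by
    have : Convex ℝ I :=
      (convex_ball (0 : Coord m) ε).linear_preimage ((LinearMap.id : ℝ →ₗ[ℝ] ℝ).smulRight e)
    exact this.isPreconnected
  have hI0 : (0 : ℝ) ∈ I := by
    have : 0 < ε := Metric.pos_of_mem_ball hσ
    simpa [hI] using this
  have hcd : ∀ s ∈ I, HasDerivAt c (deriv c s) s := fun s hs =>
    ((h.contDiffAt_center hm hs).differentiableAt (by simp)).hasDerivAt
  have hρd : ∀ s ∈ I, HasDerivAt ρ (deriv ρ s) s := fun s hs =>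
    ((h.contDiffAt_radius hm hs).differentiableAt (by simp)).hasDerivAt
  have hcid : ∀ i, ∀ s ∈ I, HasDerivAt (fun s => c s i) (deriv c s i) s := fun i s hs =>
    (EuclideanSpace.proj (𝕜 := ℝ) i).hasFDerivAt.comp_hasDerivAt s (hcd s hs)
  have hrel : ∀ s ∈ I, ∀ i, height (c s) * deriv c s i
      = (deriv ρ s / 2) * (EuclideanSpace.single (Fin.last m) (1 : ℝ) : Coord m) i :=
    fun s hs i => congrArg (fun v : Coord m => v i)
      (h.height_smul_deriv_center_of_nowhere_horizontal hm hH hHm hnh hs)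
  have hpos : ∀ s ∈ I, 0 < height (c s) := fun s hs => by
    have := h.center_pos _ hs
    rwa [map_smul, h.apply_e, smul_eq_mul, mul_one] at this
  constructor
  · intro i hi
    have hd : ∀ s ∈ I, HasDerivAt (fun s => c s i) 0 s := fun s hs => by
      have h1 := hrel s hs i
      have h2 : (EuclideanSpace.single (Fin.last m) (1 : ℝ) : Coord m) i = 0 := by simp [hi]
      rw [h2, mul_zero] at h1
      have h3 := hcid i s hs
      rwa [(mul_eq_zero.1 h1).resolve_left (hpos s hs).ne'] at h3
    exact hIo.is_const_of_deriv_eq_zero hIc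
      (fun s hs => (hd s hs).differentiableAt.differentiableWithinAt)
      (fun s hs => (hd s hs).deriv) hσ hI0
  -- The derivative is `2 k k' - ρ'`, which is zero by the last coordinate of the center equation.
  · have hd : ∀ s ∈ I, HasDerivAt (fun s => height (c s) ^ 2 - ρ s) 0 s := fun s hs => by
      have h1 := hrel s hs (Fin.last m)
      have h3 := ((hcid (Fin.last m) s hs).fun_pow 2).fun_sub (hρd s hs)
      refine h3.congr_deriv ?_
      simp [height] at h1 ⊢
      linarith
    exact hIo.is_const_of_deriv_eq_zero hIc
      (fun s hs => (hd s hs).differentiableAt.differentiableWithinAt)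
      (fun s hs => (hd s hs).deriv) hσ hI0

end IsSphereFamily

/-! ### Coordinates adapted to the foliation -/

/-- A function with nonzero differential becomes linear in suitable coordinates. -/
theorem exists_straightening {m : ℕ} {U : Set (Coord m)} (hU : IsOpen U) {S : Coord m → ℝ}
    {z₀ : Coord m} (hz₀ : z₀ ∈ U) (hS : ∀ z ∈ U, ContDiffAt ℝ ∞ S z) (hS₀ : fderiv ℝ S z₀ ≠ 0) :
    ∃ (T : OpenPartialHomeomorph (Coord m) (Coord m)) (ℓ : Coord m →L[ℝ] ℝ) (e : Coord m),
      ℓ e = 1 ∧ T 0 = z₀ ∧ ∀ᶠ w in 𝓝 (0 : Coord m), w ∈ T.source ∧ T w ∈ U ∧ ContDiffAt ℝ ∞ T w ∧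
        Function.Injective (fderiv ℝ T w) ∧ S (T w) = S z₀ + ℓ w := by
  set ℓ := fderiv ℝ S z₀ with hℓ
  obtain ⟨u, hu⟩ : ∃ u, ℓ u ≠ 0 := by
    by_contra! h
    exact hS₀ (ContinuousLinearMap.ext h)
  set e := (ℓ u)⁻¹ • u with he
  have hℓe : ℓ e = 1 := by rw [he, map_smul, smul_eq_mul, inv_mul_cancel₀ hu]
  -- The `e`-component `ℓ (z - z₀)` is replaced by `S z - S z₀`. Hence `ℓ ∘ θ = S - S z₀`, and the
  -- derivative of `θ` at `z₀` is the identity.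
  set θ : Coord m → Coord m := fun z => (z - z₀ - ℓ (z - z₀) • e) + (S z - S z₀) • e with hθ
  have hθs : ∀ z ∈ U, ContDiffAt ℝ ∞ θ z := fun z hz => by
    have h1 : ContDiffAt ℝ ∞ (fun z => ℓ (z - z₀)) z := by fun_prop
    exact ((contDiffAt_id.sub contDiffAt_const).sub (h1.smul contDiffAt_const)).add
      (((hS z hz).sub contDiffAt_const).smul contDiffAt_const)
  have hθd : HasFDerivAt θ (ContinuousLinearEquiv.refl ℝ (Coord m) : Coord m →L[ℝ] Coord m) z₀ := by
    have h0 : HasFDerivAt (fun z : Coord m => z - z₀) (ContinuousLinearMap.id ℝ (Coord m)) z₀ :=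
      (hasFDerivAt_id z₀).sub_const z₀
    have h1 : HasFDerivAt (fun z => ℓ (z - z₀)) ℓ z₀ := by
      have := HasFDerivAt.comp (g := ℓ) (f := fun z => z - z₀) z₀ ℓ.hasFDerivAt h0
      rwa [ContinuousLinearMap.comp_id] at this
    have h2 : HasFDerivAt S ℓ z₀ := ((hS z₀ hz₀).differentiableAt (by simp)).hasFDerivAt
    refine ((h0.sub (h1.smul_const e)).add ((h2.sub_const (S z₀)).smul_const e)).congr_fderiv ?_
    refine ContinuousLinearMap.ext fun v => ?_
    simp
  set Q := (hθs z₀ hz₀).toOpenPartialHomeomorph θ hθd (by simp) with hQ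
  have hQc : ⇑Q = θ := rfl
  have hz₀Q : z₀ ∈ Q.source :=
    (hθs z₀ hz₀).mem_toOpenPartialHomeomorph_source hθd (by simp)
  have hθ₀ : θ z₀ = 0 := by simp [hθ]
  have h0t : (0 : Coord m) ∈ Q.target := by rw [← hθ₀]; exact Q.map_source hz₀Q
  have hsymm0 : Q.symm 0 = z₀ := by
    have := Q.left_inv hz₀Q
    rwa [hQc, hθ₀] at this
  refine ⟨Q.symm, ℓ, e, hℓe, hsymm0, ?_⟩
  have hcont : Filter.Tendsto Q.symm (𝓝 0) (𝓝 z₀) := by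
    have := Q.symm.continuousAt (x := 0) h0t
    rwa [ContinuousAt, hsymm0] at this
  have hinv : ∀ᶠ z in 𝓝 z₀, fderiv ℝ θ z ∈
      Set.range ((↑) : (Coord m ≃L[ℝ] Coord m) → Coord m →L[ℝ] Coord m) := by
    have h1 : ContinuousAt (fderiv ℝ θ) z₀ :=
      ((hθs z₀ hz₀).fderiv_right (m := ∞) (by simp)).continuousAt
    refine h1.eventually_mem ?_
    rw [hθd.fderiv]
    exact ContinuousLinearEquiv.nhds _
  filter_upwards [Q.open_target.mem_nhds h0t, hcont.eventually (hU.mem_nhds hz₀),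
    hcont.eventually hinv] with w hw hwU ⟨L, hL⟩
  have hd : HasFDerivAt Q (L : Coord m →L[ℝ] Coord m) (Q.symm w) := by
    rw [hL]; exact ((hθs _ hwU).differentiableAt (by simp)).hasFDerivAt
  refine ⟨hw, hwU, Q.contDiffAt_symm hw hd (hθs _ hwU), ?_, ?_⟩
  · rw [(Q.hasFDerivAt_symm hw hd).fderiv]
    exact L.symm.injective
  · have h1 : θ (Q.symm w) = w := Q.right_inv hw
    have h2 := congrArg ℓ h1
    simp only [hθ, map_add, map_sub, map_smul, smul_eq_mul, hℓe] at h2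
    linarith

section Hypersurface

variable {m : ℕ} {M : Type*}

/-- Coordinates of a foliated immersed hypersurface in which the plaques are the level sets of a
linear functional. -/
structure IsFoliatedCoordinates [TopologicalSpace M] (X : M → Coord m × ℝ) (F : Setoid M) (p : M) (κ : Coord m → M)
    (ℓ : Coord m →L[ℝ] ℝ) (e : Coord m) (ε : ℝ) : Prop where
  pos : 0 < ε
  apply_e : ℓ e = 1
  apply_zero : κ 0 = p
  map_nhds : ∀ w ∈ Metric.ball (0 : Coord m) ε, Filter.map κ (𝓝 w) = 𝓝 (κ w)
  smooth : ∀ w ∈ Metric.ball (0 : Coord m) ε, ContDiffAt ℝ ∞ (X ∘ κ) w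
  inj : ∀ w ∈ Metric.ball (0 : Coord m) ε, Function.Injective (fderiv ℝ (X ∘ κ) w)
  rel : ∀ w ∈ Metric.ball (0 : Coord m) ε, ∀ w' ∈ Metric.ball (0 : Coord m) ε,
    ℓ w = ℓ w' → F (κ w) (κ w')

theorem exists_foliatedCoordinates [TopologicalSpace M] [ChartedSpace (Coord m) M]
    [IsManifold 𝓘(ℝ, Coord m) ∞ M] {X : M → Coord m × ℝ} {F : Setoid M} (hX : IsImmersedHypersurface X) (hF : IsFoliationByHorizontalSpheres X F)
    (p : M) : ∃ κ ℓ e ε, IsFoliatedCoordinates X F p κ ℓ e ε := by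
  obtain ⟨V, s, hV, hpV, hs, hds, hrel⟩ := hF.plaque p
  set φ := chartAt (Coord m) p with hφ
  have hφm : φ.MDifferentiable 𝓘(ℝ, Coord m) 𝓘(ℝ, Coord m) := by
    have : IsManifold 𝓘(ℝ, Coord m) 1 M := IsManifold.of_le (n := ∞)
      (WithTop.coe_le_coe.2 le_top)
    exact mdifferentiable_chart p
  have hps : p ∈ φ.source := mem_chart_source _ p
  have hsm : ∀ z ∈ φ.target, ContMDiffAt 𝓘(ℝ, Coord m) 𝓘(ℝ, Coord m) ∞ φ.symm z := fun z hz =>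
    (contMDiffOn_chart_symm (x := p) z hz).contMDiffAt (φ.open_target.mem_nhds hz)
  set U : Set (Coord m) := φ.target ∩ φ.symm ⁻¹' V with hU
  have hUo : IsOpen U := φ.symm.isOpen_inter_preimage hV
  have hz₀ : φ p ∈ U := ⟨φ.map_source hps, by
    rw [Set.mem_preimage, φ.left_inv hps]; exact hpV⟩
  have hsat : ∀ z ∈ U, ContMDiffAt 𝓘(ℝ, Coord m) 𝓘(ℝ, ℝ) ∞ s (φ.symm z) := fun z hz =>
    (hs _ hz.2).contMDiffAt (hV.mem_nhds hz.2)
  have hS : ∀ z ∈ U, ContDiffAt ℝ ∞ (s ∘ φ.symm) z := fun z hz =>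
    contMDiffAt_iff_contDiffAt.1 ((hsat z hz).comp z (hsm z hz.1))
  have hS₀ : fderiv ℝ (s ∘ φ.symm) (φ p) ≠ 0 := by
    intro h0
    have h1 : mfderiv 𝓘(ℝ, Coord m) 𝓘(ℝ, ℝ) (s ∘ φ.symm) (φ p)
        = (mfderiv 𝓘(ℝ, Coord m) 𝓘(ℝ, ℝ) s (φ.symm (φ p))).comp
          (mfderiv 𝓘(ℝ, Coord m) 𝓘(ℝ, Coord m) φ.symm (φ p)) :=
      mfderiv_comp (φ p) ((hsat _ hz₀).mdifferentiableAt (by simp))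
        ((hsm _ hz₀.1).mdifferentiableAt (by simp))
    rw [mfderiv_eq_fderiv, h0] at h1
    apply hds _ hz₀.2
    refine ContinuousLinearMap.ext fun v => ?_
    obtain ⟨u, rfl⟩ := hφm.symm.mfderiv_surjective hz₀.1 v
    exact (DFunLike.congr_fun h1 u).symm
  obtain ⟨T, ℓ, e, hℓe, hT0, hT⟩ := exists_straightening hUo hz₀ hS hS₀
  obtain ⟨ε, hε, hball⟩ := Metric.eventually_nhds_iff_ball.1 hT
  have hXs : ∀ z ∈ φ.target, ContDiffAt ℝ ∞ (X ∘ φ.symm) z := fun z hz =>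
    contMDiffAt_iff_contDiffAt.1 ((hX.smooth _).comp z (hsm z hz))
  have hXi : ∀ z ∈ φ.target, Function.Injective (fderiv ℝ (X ∘ φ.symm) z) := fun z hz => by
    have h1 : mfderiv 𝓘(ℝ, Coord m) 𝓘(ℝ, Coord m × ℝ) (X ∘ φ.symm) z
        = (mfderiv 𝓘(ℝ, Coord m) 𝓘(ℝ, Coord m × ℝ) X (φ.symm z)).comp
          (mfderiv 𝓘(ℝ, Coord m) 𝓘(ℝ, Coord m) φ.symm z) :=
      mfderiv_comp z ((hX.smooth _).mdifferentiableAt (by simp))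
        ((hsm _ hz).mdifferentiableAt (by simp))
    rw [mfderiv_eq_fderiv] at h1
    rw [h1]
    exact (hX.immersive _).comp (hφm.symm.mfderiv_injective hz)
  refine ⟨φ.symm ∘ T, ℓ, e, ε, hε, hℓe, ?_, fun w hw => ?_, fun w hw => ?_, fun w hw => ?_,
    fun w hw w' hw' h => ?_⟩
  · rw [Function.comp, hT0, φ.left_inv hps]
  · obtain ⟨h1, h2, -, -, -⟩ := hball w hw
    rw [← Filter.map_map, T.map_nhds_eq h1, φ.symm.map_nhds_eq h2.1]
    rfl
  · obtain ⟨h1, h2, h3, -, -⟩ := hball w hw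
    exact ContDiffAt.comp (g := X ∘ φ.symm) w (hXs _ h2.1) h3
  · obtain ⟨h1, h2, h3, h4, -⟩ := hball w hw
    have h5 : fderiv ℝ ((X ∘ φ.symm) ∘ T) w = (fderiv ℝ (X ∘ φ.symm) (T w)).comp (fderiv ℝ T w) :=
      fderiv_comp w ((hXs _ h2.1).differentiableAt (by simp)) (h3.differentiableAt (by simp))
    rw [← Function.comp_assoc, h5]
    exact (hXi _ h2.1).comp h4
  · obtain ⟨-, h2, -, -, h5⟩ := hball w hw
    obtain ⟨-, h2', -, -, h5'⟩ := hball w' hw'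
    refine hrel _ h2.2 _ h2'.2 ?_
    have : (s ∘ φ.symm) (T w) = (s ∘ φ.symm) (T w') := by rw [h5, h5', h]
    exact this

/-! ### From leaves to sphere families, and from local to global -/

/-- A choice of hyperbolic centers `a`, radii `R` and heights `t` of the leaves of a foliation by
horizontal spheres. -/
structure IsLeafData (X : M → Coord m × ℝ) (F : Setoid M) (a : M → Coord m) (R t : M → ℝ) :
    Prop where
  center_mem : ∀ p, a p ∈ halfSpace m
  radius_pos : ∀ p, 0 < R p
  bijOn : ∀ p, Set.BijOn X {x | F p x} (hsphere (a p) (R p) ×ˢ {t p})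
  congr : ∀ p p', F p p' → a p = a p' ∧ R p = R p' ∧ t p = t p'

theorem exists_leafData [TopologicalSpace M] [ChartedSpace (Coord m) M]
    {X : M → Coord m × ℝ} {F : Setoid M} (hF : IsFoliationByHorizontalSpheres X F) : ∃ a R t, IsLeafData X F a R t := by
  choose a ha R hR t hbij using hF.leaf
  -- Data are chosen at one representative of each leaf, so that they are constant along leaves by
  -- construction.
  set r : M → M := fun p => (Quotient.mk F p).out with hr
  have hrF : ∀ p, F (r p) p := fun p => Quotient.exact (Quotient.out_eq _)
  refine ⟨a ∘ r, R ∘ r, t ∘ r, fun p => ha _, fun p => hR _, fun p => ?_, fun p p' hp => ?_⟩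
  · have : {x | F p x} = {x | F (r p) x} := by
      ext x
      exact ⟨fun h => F.trans (hrF p) h, fun h => F.trans (F.symm (hrF p)) h⟩
    rw [this]
    exact hbij _
  · have : r p = r p' := by
      simp only [hr]
      rw [Quotient.sound hp]
    simp [this]

theorem IsLeafData.mem {X : M → Coord m × ℝ} {F : Setoid M} {a : M → Coord m} {R t : M → ℝ}
    (h : IsLeafData X F a R t) (p : M) : X p ∈ hsphere (a p) (R p) ×ˢ {t p} :=
  (h.bijOn p).mapsTo (F.refl p)

/-- The segment in the direction `e` is a transversal. On a smaller ball the plaque through `w`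
meets it at `ℓ w • e` without leaving the coordinate domain, so center and radius become functions
of the single parameter `ℓ w`. -/
theorem IsFoliatedCoordinates.exists_isSphereFamily [TopologicalSpace M] [ChartedSpace (Coord m) M]
    {X : M → Coord m × ℝ} {F : Setoid M}
    {a : M → Coord m} {R t : M → ℝ} (hL : IsLeafData X F a R t) (hX : IsImmersedHypersurface X)
    {p : M} {κ : Coord m → M} {ℓ : Coord m →L[ℝ] ℝ} {e : Coord m} {ε : ℝ}
    (h : IsFoliatedCoordinates X F p κ ℓ e ε) :
    ∃ δ, 0 < δ ∧ δ ≤ ε ∧ (∀ w ∈ Metric.ball (0 : Coord m) δ, F (κ w) (κ (ℓ w • e))) ∧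
      IsSphereFamily (X ∘ κ) (Metric.ball 0 δ) ℓ e
        (fun σ => euclCenter (a (κ (σ • e))) (R (κ (σ • e))))
        (fun σ => (height (a (κ (σ • e))) * Real.sinh (R (κ (σ • e)))) ^ 2) := by
  have hcont : Continuous fun w => ℓ w • e := by fun_prop
  have h1 : ∀ᶠ w in 𝓝 (0 : Coord m), ℓ w • e ∈ Metric.ball (0 : Coord m) ε :=
    (hcont.tendsto' 0 0 (by simp)).eventually (Metric.ball_mem_nhds 0 h.pos)
  obtain ⟨δ₁, hδ₁, hb⟩ := Metric.eventually_nhds_iff_ball.1 h1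
  have hsub : Metric.ball (0 : Coord m) (min δ₁ ε) ⊆ Metric.ball 0 ε :=
    Metric.ball_subset_ball (min_le_right _ _)
  have hrel : ∀ w ∈ Metric.ball (0 : Coord m) (min δ₁ ε), F (κ w) (κ (ℓ w • e)) := fun w hw =>
    h.rel _ (hsub hw) _ (hb _ (Metric.ball_subset_ball (min_le_left _ _) hw)) (by simp [h.apply_e])
  have hapos : ∀ q, 0 < height (a q) := hL.center_mem
  refine ⟨min δ₁ ε, lt_min hδ₁ h.pos, min_le_right _ _, hrel, Metric.isOpen_ball, h.apply_e,
    fun w hw => h.smooth w (hsub hw), fun w hw => h.inj w (hsub hw), fun w hw w' hw' hww' => ?_,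
    fun w hw => ?_, fun w _ => hX.mem_halfSpace _, fun w _ => ?_, fun w _ => ?_, fun w _ => ?_⟩
  · have e1 : (X (κ w)).2 = t (κ w) := (hL.mem (κ w)).2
    have e2 : (X (κ w')).2 = t (κ w') := (hL.mem (κ w')).2
    have e3 := (hL.congr _ _ (h.rel _ (hsub hw) _ (hsub hw') hww')).2.2
    simp only [Function.comp, e1, e2, e3]
  · obtain ⟨e1, e2, -⟩ := hL.congr _ _ (hrel w hw)
    simp only [← e1, ← e2]
    exact norm_sub_euclCenter_sq (hL.center_mem _) (hL.mem (κ w)).1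
  · have := Real.sinh_pos_iff.2 (hL.radius_pos (κ (ℓ w • e)))
    have := hapos (κ (ℓ w • e))
    positivity
  · simp only [height_euclCenter]
    exact mul_pos (hapos _) (Real.cosh_pos _)
  · simp only [height_euclCenter, mul_pow, Real.cosh_sq]
    nlinarith [pow_pos (hapos (κ (ℓ w • e))) 2]

theorem IsFoliatedCoordinates.hasMeanCurvatureNear [TopologicalSpace M]
    {X : M → Coord m × ℝ} {F : Setoid M} {H : ℝ} (hH : HasConstantMeanCurvature X H)
    {p : M} {κ : Coord m → M} {ℓ : Coord m →L[ℝ] ℝ} {e : Coord m} {ε : ℝ}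
    (h : IsFoliatedCoordinates X F p κ ℓ e ε) {w : Coord m} (hw : w ∈ Metric.ball (0 : Coord m) ε) :
    HasMeanCurvatureNear (X ∘ κ) H w := by
  obtain ⟨U, f, hU, hpU, hf, hdf, hev⟩ := hH (κ w)
  refine ⟨U, f, hU, hpU, hf, hdf, ?_⟩
  rw [← h.map_nhds w hw] at hev
  exact hev

/-- If a foliated hypersurface of constant mean curvature is not contained in a horizontal slice,
then it is nowhere horizontal. -/
theorem nowhere_horizontal [TopologicalSpace M] [ChartedSpace (Coord m) M]
    [ConnectedSpace M] [IsManifold 𝓘(ℝ, Coord m) ∞ M]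
    {X : M → Coord m × ℝ} {F : Setoid M} {H : ℝ} (hX : IsImmersedHypersurface X)
    (hH : HasConstantMeanCurvature X H) (hF : IsFoliationByHorizontalSpheres X F)
    (hslice : ¬ ∃ t : ℝ, ∀ p : M, (X p).2 = t) (p : M) :
    ¬ ∀ᶠ v in 𝓝 p, (X v).2 = (X p).2 := by
  intro hp
  obtain ⟨a, R, t, hL⟩ := exists_leafData hF
  -- A horizontal slice is minimal, so one horizontal piece puts the hypersurface in the case where
  -- unique continuation applies.
  have hH0 : H = 0 := by
    obtain ⟨κ, ℓ, e, ε, hκ⟩ := exists_foliatedCoordinates hX hF p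
    obtain ⟨δ, hδ, hδε, -, hfam⟩ := hκ.exists_isSphereFamily hL hX
    have h0 : (0 : Coord m) ∈ Metric.ball (0 : Coord m) δ := Metric.mem_ball_self hδ
    have h0' := Metric.ball_subset_ball hδε h0
    refine hfam.eq_zero_of_horizontal h0 (hκ.hasMeanCurvatureNear hH h0') ?_
    have := hκ.map_nhds 0 h0'
    rw [hκ.apply_zero] at this
    rw [← this, Filter.eventually_map] at hp
    simpa [hκ.apply_zero] using hp
  subst hH0
  set Z : Set M := {q | ∀ᶠ v in 𝓝 q, (X v).2 = (X q).2} with hZ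
  have hZo : IsOpen Z := by
    rw [isOpen_iff_mem_nhds]
    intro q hq
    have hq' : ∀ᶠ v in 𝓝 q, (X v).2 = (X q).2 := hq
    filter_upwards [hq'.eventually_nhds, hq'] with v hv hv'
    filter_upwards [hv] with u hu
    rw [hu, hv']
  have hZc : IsClosed Z := by
    rw [← isOpen_compl_iff, isOpen_iff_mem_nhds]
    intro q hq
    obtain ⟨κ, ℓ, e, ε, hκ⟩ := exists_foliatedCoordinates hX hF q
    obtain ⟨δ, hδ, hδε, -, hfam⟩ := hκ.exists_isSphereFamily hL hX
    have hsub := Metric.ball_subset_ball (x := (0 : Coord m)) hδε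
    have h0 : (0 : ℝ) • e ∈ Metric.ball (0 : Coord m) δ := by simpa using hδ
    have hmap := hκ.map_nhds 0 (Metric.mem_ball_self hκ.pos)
    rw [hκ.apply_zero] at hmap
    -- If the leaf height were stationary at `q`, unique continuation would put `q` in `Z`. The
    -- nonvanishing persists on nearby leaves and excludes them from `Z`.
    have hne : deriv (IsSphereFamily.slice (X ∘ κ) e) 0 ≠ 0 := by
      intro hd
      apply hq
      have h1 := hfam.eventually_snd_eq h0 (hfam.eventually_deriv_slice_eq_zero
        (fun w hw => hκ.hasMeanCurvatureNear hH (hsub hw)) h0 hd)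
      rw [zero_smul] at h1
      change ∀ᶠ v in 𝓝 q, (X v).2 = (X q).2
      rw [← hmap, Filter.eventually_map]
      simpa [hκ.apply_zero] using h1
    have hcont : ContinuousAt (deriv (IsSphereFamily.slice (X ∘ κ) e)) 0 :=
      (contDiffAt_deriv (k := ∞) (hfam.contDiffAt_slice h0) (by simp)).continuousAt
    have htend : Filter.Tendsto ℓ (𝓝 0) (𝓝 0) := ℓ.continuous.tendsto' _ _ (map_zero ℓ)
    have hmem : ∀ᶠ w in 𝓝 (0 : Coord m), ℓ w • e ∈ Metric.ball (0 : Coord m) δ :=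
      htend.eventually (hfam.eventually_mem h0)
    change ∀ᶠ v in 𝓝 q, v ∈ Zᶜ
    rw [← hmap, Filter.eventually_map]
    filter_upwards [htend.eventually (hcont.eventually_ne hne), hmem,
      Metric.ball_mem_nhds 0 hδ] with w hw hw' hwδ hwZ
    apply hw
    refine hfam.deriv_slice_eq_zero_of_horizontal hwδ hw' ?_
    have hwZ' : ∀ᶠ v in 𝓝 (κ w), (X v).2 = (X (κ w)).2 := hwZ
    rw [← hκ.map_nhds w (hsub hwδ)] at hwZ'
    exact hwZ'
  have hZu : Z = Set.univ := IsClopen.eq_univ ⟨hZc, hZo⟩ ⟨p, hp⟩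
  have hlc : IsLocallyConstant fun q => (X q).2 :=
    IsLocallyConstant.iff_eventually_eq _ |>.2 fun q => by
      have : q ∈ Z := hZu ▸ Set.mem_univ q
      exact this
  exact hslice ⟨(X p).2, fun q => hlc.apply_eq_of_preconnectedSpace q p⟩

/-- In a coordinate ball the two invariants of the Euclidean spheres are constant, so the hyperbolic
center is locally constant; connectedness of `M` does the rest. -/
theorem center_eq [TopologicalSpace M] [ChartedSpace (Coord m) M]
    [ConnectedSpace M] [IsManifold 𝓘(ℝ, Coord m) ∞ M] (hm : 1 ≤ m)
    {X : M → Coord m × ℝ} {F : Setoid M} {H : ℝ} (hX : IsImmersedHypersurface X)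
    (hH : HasConstantMeanCurvature X H) (hF : IsFoliationByHorizontalSpheres X F)
    (hslice : ¬ ∃ t : ℝ, ∀ p : M, (X p).2 = t) (hHm : H ≠ 0 ∨ m ≠ 1)
    {a : M → Coord m} {R t : M → ℝ} (hL : IsLeafData X F a R t) (p q : M) : a p = a q := by
  have hlc : IsLocallyConstant a := IsLocallyConstant.iff_eventually_eq _ |>.2 fun p => by
    obtain ⟨κ, ℓ, e, ε, hκ⟩ := exists_foliatedCoordinates hX hF p
    obtain ⟨δ, hδ, hδε, hrel, hfam⟩ := hκ.exists_isSphereFamily hL hX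
    have hsub := Metric.ball_subset_ball (x := (0 : Coord m)) hδε
    have hmap := hκ.map_nhds 0 (Metric.mem_ball_self hκ.pos)
    rw [hκ.apply_zero] at hmap
    have hnh : ∀ w ∈ Metric.ball (0 : Coord m) δ,
        ¬ ∀ᶠ v in 𝓝 w, ((X ∘ κ) v).2 = ((X ∘ κ) w).2 := fun w hw hcon => by
      refine nowhere_horizontal hX hH hF hslice (κ w) ?_
      rw [← hκ.map_nhds w (hsub hw)]
      exact hcon
    have h0 : (0 : ℝ) • e ∈ Metric.ball (0 : Coord m) δ := by simpa using hδ
    have htend : Filter.Tendsto ℓ (𝓝 0) (𝓝 0) := ℓ.continuous.tendsto' _ _ (map_zero ℓ)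
    have hmem : ∀ᶠ w in 𝓝 (0 : Coord m), ℓ w • e ∈ Metric.ball (0 : Coord m) δ :=
      htend.eventually (hfam.eventually_mem h0)
    rw [← hmap, Filter.eventually_map]
    filter_upwards [hmem, Metric.ball_mem_nhds 0 hδ] with w hw hwδ
    obtain ⟨h1, h2⟩ := hfam.center_invariants hm
      (fun w hw => hκ.hasMeanCurvatureNear hH (hsub hw)) hHm hnh hw
    have h3 := eq_of_center_invariants (hL.center_mem _) (hL.center_mem _) h1 h2
    rw [zero_smul, hκ.apply_zero] at h3
    rw [(hL.congr _ _ (hrel w hwδ)).1, h3]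
  exact hlc.apply_eq_of_preconnectedSpace p q

end Hypersurface

/-! ### Rotational symmetry of the image -/

theorem image_hsphere_of_isHypIsometry {m : ℕ} {g : Coord m → Coord m} (hg : IsHypIsometry g)
    {q : Coord m} (hq : q ∈ halfSpace m) (hgq : g q = q) (R : ℝ) :
    g '' hsphere q R = hsphere q R := by
  ext x
  constructor
  · rintro ⟨y, ⟨hy, hyd⟩, rfl⟩
    refine ⟨hg.1.mapsTo hy, ?_⟩
    have := hg.2 y hy q hq
    rw [hgq] at this
    rw [this, hyd]
  · rintro ⟨hx, hxd⟩
    obtain ⟨y, hy, rfl⟩ := hg.1.surjOn hx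
    have := hg.2 y hy q hq
    rw [hgq] at this
    exact ⟨y, ⟨hy, by rw [← this, hxd]⟩, rfl⟩

theorem isRotationallySymmetricAbout_range {m : ℕ} {M : Type*} {X : M → Coord m × ℝ}
    {q : Coord m} (hq : q ∈ halfSpace m) (C : M → Set M) (hC : ∀ p, p ∈ C p)
    (himage : ∀ p, ∃ (R t : ℝ), X '' C p = hsphere q R ×ˢ {t}) :
    IsRotationallySymmetricAbout (Set.range X) q := by
  intro g hg hgq
  have hS : ∀ R : ℝ, g '' hsphere q R = hsphere q R := image_hsphere_of_isHypIsometry hg hq hgq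
  ext y
  constructor
  · rintro ⟨_, ⟨p, rfl⟩, rfl⟩
    obtain ⟨R, t, h⟩ := himage p
    have h1 : X p ∈ hsphere q R ×ˢ {t} := h ▸ Set.mem_image_of_mem X (hC p)
    have h2 : (g (X p).1, (X p).2) ∈ hsphere q R ×ˢ {t} :=
      ⟨hS R ▸ Set.mem_image_of_mem g h1.1, h1.2⟩
    rw [← h] at h2
    exact Set.image_subset_range _ _ h2
  · rintro ⟨p, rfl⟩
    obtain ⟨R, t, h⟩ := himage p
    have h1 : X p ∈ hsphere q R ×ˢ {t} := h ▸ Set.mem_image_of_mem X (hC p)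
    have h2 := h1.1
    rw [← hS R] at h2
    obtain ⟨x, hx, hgx⟩ := h2
    have h3 : (x, (X p).2) ∈ hsphere q R ×ˢ {t} := ⟨hx, h1.2⟩
    rw [← h] at h3
    exact ⟨_, Set.image_subset_range _ _ h3, Prod.ext hgx rfl⟩

end HypProd

end

theorem theorem1 (m : ℕ) (hm : 2 ≤ m + 1)
    {M : Type*} [TopologicalSpace M] [T2Space M] [SecondCountableTopology M] [ConnectedSpace M]
    [ChartedSpace (HypProd.Coord m) M] [IsManifold 𝓘(ℝ, HypProd.Coord m) ∞ M]
    (X : M → HypProd.Coord m × ℝ) (F : Setoid M) (H : ℝ)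
    (hX : HypProd.IsImmersedHypersurface X)
    (hH : HypProd.HasConstantMeanCurvature X H)
    (hF : HypProd.IsFoliationByHorizontalSpheres X F)
    (hslice : ¬ ∃ t : ℝ, ∀ p : M, (X p).2 = t)
    (h : H ≠ 0 ∨ (H = 0 ∧ 3 ≤ m + 1)) :
    ∃ q ∈ HypProd.halfSpace m,
      (∀ p : M, ∃ R > 0, ∃ t : ℝ, X '' {x | F p x} = HypProd.hsphere q R ×ˢ {t}) ∧
      HypProd.IsRotationallySymmetricAbout (Set.range X) q := by
  obtain ⟨a, R, t, hL⟩ := HypProd.exists_leafData hF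
  obtain ⟨p₀⟩ : Nonempty M := inferInstance
  -- Since `n = m + 1`, the excluded minimal case `n = 2` is `m = 1`, where the factor `m - 1` in
  -- the complexified equation vanishes.
  have hHm : H ≠ 0 ∨ m ≠ 1 := h.imp_right fun h => by omega
  have hcenter := HypProd.center_eq (by omega) hX hH hF hslice hHm hL
  have himage : ∀ p : M, X '' {x | F p x} = HypProd.hsphere (a p₀) (R p) ×ˢ {t p} := fun p => by
    rw [(hL.bijOn p).image_eq, hcenter p p₀]
  exact ⟨a p₀, hL.center_mem p₀, fun p => ⟨R p, hL.radius_pos p, t p, himage p⟩,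
    HypProd.isRotationallySymmetricAbout_range (hL.center_mem p₀) (fun p => {x | F p x})
      (fun p => F.refl p) fun p => ⟨R p, t p, himage p⟩⟩
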